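/- **Setting.** Let $n=4^k$ and $N=\sqrt n=2^k$. The *$n$-MM problem* is to multiply two $N\times N$ matrices $A,B$ using only semiring operations. A *static algorithm* for it on $q=2^a$ processing elements $P_0,\dots,P_{q-1}$ is a fixed (input-independent) sequence of supersteps. In a superstep each processing element executes a straight-line sequence of semiring operations ($0$, $1$, $+$, $\cdot$) on cells of its own unbounded local memory and then sends messages, each carrying one semiring element, which are available after the superstep. A superstep has a label $i\ge 0$; in a superstep with label $i<a$ (an $i$-superstep) messages are exchanged only between processing elements whose indices agree in the $i$ most significant of their $a$ bits, and steps with labels $i\ge a$ are local computation. Initially some cells contain entries of $A$ and $B$ (the others contain $0$), and at the end designated cells contain the entries of $AB$, for all $A,B$ over every semiring. The *folding* on $q'=2^b<q$ processing elements lets $P_j$ carry out the operations of the $q/q'$ consecutive old processing elements starting with the $j(q/q')$-th one; labels are kept, so that supersteps with label $\ge b$ become local computation. The *degree* of a superstep is the maximum, over all processing elements, of the number of messages sent to, or received from, other processing elements (whichever is larger). $F^i$ is the sum of the degrees of the $i$-supersteps and $S^i$ is their number. For $g=(g_0,\dots,g_{\log_2 p-1})$ with $g_i>0$ and $\ell=(\ell_0,\dots,\ell_{\log_2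 p-1})$ with $\ell_i\ge0$, the *communication time* of an algorithm on the machine D-BSP$(p,g,\ell)$ with $p$ processors is $D=\sum_{i=0}^{\log_2 p-1}(F^i g_i+S^i\ell_i)$. **Class $\mathscr C$.** A static $n$-MM algorithm on $q$ processing elements belongs to $\mathscr C$ if (i) no entry of $A$ or $B$ is initially replicated; (ii) no processing element computes more than $n^{3/2}/\min\{q,11^3\}$ multiplicative terms, i.e. (symbolic) products $A[i,k]\cdot B[k,j]$; (iii) all its foldings on $q'$ processing elements, $2\le q'<q$ a power of two, belong to $\mathscr C$. For $0<\beta\le1$, an algorithm on $p$ processors is *$\beta$-optimal on D-BSP$(p,g,\ell)$ with respect to $\mathscr C$* (for size $n$) if it belongs to $\mathscr C$ and its communication time is at most $1/\beta$ times that of every algorithm in $\mathscr C$ for $p$ processors and size $n$. **The network-oblivious algorithm.** It is designed for $n$ virtual processors $\mathrm{VP}_0,\dots,\mathrm{VP}_{n-1}$, with $A,B,C=AB$ evenly distributed, one entry of each per processor, in row-major order. On recursion level $0\le i<\lceil(\log_2 n)/3\rceil$ there are $8^i$ independent $(n/4^i)$-MM subproblems, each owning a segment of $n/8^i$ consecutive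 virtual processors over which its three matrices are spread evenly in row-major order. In a $3i$-superstep, for each subproblem and each $(h,k,l)\in\{0,1\}^3$, copies of the quadrants $A_{hl}$ and $B_{lk}$ are spread evenly over the $(4h+2k+l)$-th eighth of the segment. These eighths then compute in parallel, recursively, $M_{hkl}=A_{hl}B_{lk}$. In a further $3i$-superstep the owner of $C[r,c]$ in the quadrant $C_{hk}$ collects the corresponding entries of $M_{hk0}$ and $M_{hk1}$, which it then adds. (If $\log_2 n$ is not divisible by $3$, then on the last level several of the eight sub-subproblems share one virtual processor.) The subproblems of level $\lceil(\log_2 n)/3\rceil$ are solved sequentially within single virtual processors. The last additions (for $n=1$, the sequential product) are done in a final $0$-superstep. In every $3i$-superstep, $\mathrm{VP}_j$ moreover sends $2^i$ dummy messages to $\mathrm{VP}_{j+n/2^{3i+1}}$, for $0\le j<n/2^{3i+1}$. **Statement.** The above algorithm is $\Theta(1)$-optimal with respect to $\mathscr C$ on every D-BSP$(p,g,\ell)$ with $1<p\le n$, non-increasing $g_i$ and $\ell_i/g_i$, and $\ell_0/g_0=O(n/p)$. That is, for every constant $K>0$ there is a constant $\beta\in(0,1]$, depending on $K$ only, such that for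 every $n=4^k$, every power of two $p$ with $1<p\le n$, and all $g,\ell$ as above with $g_0\ge g_1\ge\dots$, $\ell_0/g_0\ge\ell_1/g_1\ge\dots$ and $\ell_0/g_0\le K\,n/p$, the folding of the algorithm on $p$ processors is $\beta$-optimal on D-BSP$(p,g,\ell)$ with respect to $\mathscr C$. -/

import Mathlib

namespace NetworkOblivious

/-! ### Straight-line semiring programs on a machine with distributed memory -/

/-- An entry of one of the two input matrices `A`, `B` of size `N × N`. -/
inductive Entry (N : ℕ) where
  | a (i j : Fin N) : Entry N
  | b (i j : Fin N) : Entry N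

/-- A local instruction: a semiring operation (the two constants, sum, product) with operands and
result in memory cells of type `γ`; `d` is the destination. -/
inductive Instr (γ : Type) where
  | zero (d : γ) : Instr γ
  | one (d : γ) : Instr γ
  | add (d x y : γ) : Instr γ
  | mul (d x y : γ) : Instr γ

/-- A superstep: local code, then messages, then a barrier `sync(label)`. A message `(x, y)` carries
the content of cell `x` (at the processing element hosting `x`) to cell `y`
(at the processing element hosting `y`). -/
structure Superstep (γ : Type) where
  label : ℕ
  code : List (Instr γ)
  msgs : List (γ × γ)

/-- A static algorithm for the multiplication of two `N × N` matrices that uses only semiring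
operations. `home c` is the index of the processing element whose local memory contains the
cell `c`; `init c` is the input entry initially stored in `c`, if any (the other cells initially
contain `0`); `out i j` is the cell that finally contains the entry `(i, j)` of the product. -/
structure Program (N : ℕ) where
  Cell : Type
  [decEq : DecidableEq Cell]
  home : Cell → ℕ
  init : Cell → Option (Entry N)
  out : Fin N → Fin N → Cell
  steps : List (Superstep Cell)

attribute [instance] Program.decEq

section Semantics

/-- Effect of an instruction on a memory with contents in a semiring. -/
def Instr.exec {γ : Type} [DecidableEq γ] {R : Type} [Semiring R] (m : γ → R) :
    Instr γ → (γ → R)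
  | .zero d => Function.update m d 0
  | .one d => Function.update m d 1
  | .add d x y => Function.update m d (m x + m y)
  | .mul d x y => Function.update m d (m x * m y)

/-- Effect of a list of instructions, executed one after the other. -/
def execCode {γ : Type} [DecidableEq γ] {R : Type} [Semiring R] (m : γ → R)
    (code : List (Instr γ)) : γ → R :=
  code.foldl Instr.exec m

/-- Effect of a superstep: the code is executed, and then all messages, which carry the contents
that the source cells have after the local code, are delivered. -/
def Superstep.exec {γ : Type} [DecidableEq γ] {R : Type} [Semiring R] (m : γ → R)
    (s : Superstep γ) : γ → R :=
  s.msgs.foldl (fun m' e => Function.update m' e.2 (execCode m s.code e.1)) (execCode m s.code)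

/-- Effect of a list of supersteps. -/
def execSteps {γ : Type} [DecidableEq γ] {R : Type} [Semiring R] (m : γ → R)
    (steps : List (Superstep γ)) : γ → R :=
  steps.foldl Superstep.exec m

/-- The initial memory when the input entry `x` has the value `val x`. -/
def Program.initMem {N : ℕ} (P : Program N) {R : Type} [Semiring R] (val : Entry N → R) :
    P.Cell → R :=
  fun c => match P.init c with
    | none => 0
    | some x => val x

/-- The values of the input entries for the input matrices `A`, `B`. -/
def entryVal {N : ℕ} {R : Type} (A B : Matrix (Fin N) (Fin N) R) : Entry N → R
  | .a i j => A i j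
  | .b i j => B i j

/-- The program multiplies any two `N × N` matrices over any semiring. -/
def Program.Correct {N : ℕ} (P : Program N) : Prop :=
  ∀ (R : Type) [Semiring R] (A B : Matrix (Fin N) (Fin N) R) (i j : Fin N),
    execSteps (P.initMem (entryVal A B)) P.steps (P.out i j) = (A * B) i j

end Semantics

section Machine

/-- `P` is a program for a machine with `2 ^ a` processing elements: every cell is in one of the
local memories, an instruction involves cells of one local memory only, and a message of a superstep
with label `i` stays within a cluster of processing elements whose indices share the `i` most
significant of their `a` bits. A step whose label is at least `a` thus involves no
communication at all: it is local computation, and it is not charged below. -/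
structure Program.Valid {N : ℕ} (P : Program N) (a : ℕ) : Prop where
  home_lt : ∀ c, P.home c < 2 ^ a
  code_local : ∀ s ∈ P.steps, ∀ I ∈ s.code,
    match I with
    | .zero _ => True
    | .one _ => True
    | .add d x y => P.home x = P.home d ∧ P.home y = P.home d
    | .mul d x y => P.home x = P.home d ∧ P.home y = P.home d
  msgs_cluster : ∀ s ∈ P.steps, ∀ e ∈ s.msgs,
    P.home e.1 / 2 ^ (a - s.label) = P.home e.2 / 2 ^ (a - s.label)

/-- Folding of a program for `2 ^ a` processing elements onto `2 ^ (a - e)` processing elements: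
the processing element `j` carries out the operations of the `2 ^ e` consecutively numbered
old ones starting with `j * 2 ^ e`. Supersteps keep their labels. -/
def Program.fold {N : ℕ} (P : Program N) (e : ℕ) : Program N :=
  { P with home := fun c => P.home c / 2 ^ e }

/-- Degree of a superstep on `2 ^ a` processing elements: the maximum number of messages that a
processing element sends to, or receives from, the other ones. -/
def Program.degree {N : ℕ} (P : Program N) (a : ℕ) (s : Superstep P.Cell) : ℕ :=
  (Finset.range (2 ^ a)).sup fun r =>
    max (s.msgs.countP fun e => P.home e.1 = r ∧ P.home e.2 ≠ r)
      (s.msgs.countP fun e => P.home e.2 = r ∧ P.home e.1 ≠ r)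

/-- The list of the supersteps with label `i`. -/
def Program.stepsWithLabel {N : ℕ} (P : Program N) (i : ℕ) : List (Superstep P.Cell) :=
  P.steps.filter fun s => s.label = i

/-- `S^i`: the number of supersteps with label `i`. -/
def Program.numSteps {N : ℕ} (P : Program N) (i : ℕ) : ℕ :=
  (P.stepsWithLabel i).length

/-- `F^i`: the cumulative degree of the supersteps with label `i`. -/
def Program.cumDegree {N : ℕ} (P : Program N) (a i : ℕ) : ℕ :=
  ((P.stepsWithLabel i).map (P.degree a)).sum

/-- The communication time on the D-BSP with `2 ^ a` processors and parameter vectors `g`, `ℓ`. -/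
noncomputable def Program.commTime {N : ℕ} (P : Program N) (a : ℕ) (g ℓ : Fin a → ℝ) : ℝ :=
  ∑ i : Fin a, ((P.cumDegree a i : ℝ) * g i + (P.numSteps i : ℝ) * ℓ i)

/-- `P` is a member of the class `𝒞` of algorithms for a D-BSP with `2 ^ a` processors and
parameter vectors `g`, `ℓ`, and `β`-optimal on this machine with respect to `𝒞`
(for one input size; `𝒞` contains the algorithms for this size). -/
def IsOptimal {N : ℕ} (𝒞 : Program N → Prop) (a : ℕ) (g ℓ : Fin a → ℝ) (β : ℝ)
    (P : Program N) : Prop :=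
  𝒞 P ∧ ∀ Q : Program N, 𝒞 Q → P.commTime a g ℓ ≤ (1 / β) * Q.commTime a g ℓ

end Machine

section MMClass

/-- No entry of the input matrices is initially stored in more than one cell. -/
def Program.NoReplication {N : ℕ} (P : Program N) : Prop :=
  ∀ (c c' : P.Cell) (x : Entry N), P.init c = some x → P.init c' = some x → c = c'

/-- The initial memory of the symbolic execution, in the free semiring on the input entries. -/
noncomputable def Program.symInit {N : ℕ} (P : Program N) : P.Cell → FreeAlgebra ℕ (Entry N) :=
  P.initMem (FreeAlgebra.ι ℕ)

/-- The triples `(i, k, j)` such that the processing element `r` computes the multiplicative term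
`A[i,k] * B[k,j]`: at some point of the execution it multiplies the contents of two of its
cells, and these contents are (as symbolic expressions) `A[i,k]` and `B[k,j]`. -/
def Program.termsComputed {N : ℕ} (P : Program N) (r : ℕ) : Set (Fin N × Fin N × Fin N) :=
  {τ | ∃ (before after : List (Superstep P.Cell)) (s : Superstep P.Cell)
      (pre post : List (Instr P.Cell)) (d x y : P.Cell),
      P.steps = before ++ s :: after ∧ s.code = pre ++ Instr.mul d x y :: post ∧
      P.home d = r ∧
      execCode (execSteps P.symInit before) pre x = FreeAlgebra.ι ℕ (Entry.a τ.1 τ.2.1) ∧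
      execCode (execSteps P.symInit before) pre y = FreeAlgebra.ι ℕ (Entry.b τ.2.1 τ.2.2)}

/-- The class of static algorithms, on `2 ^ a` processing elements, for the `n`-MM problem with
`n = N ^ 2`, so that `n ^ (3 / 2) = N ^ 3`: (i) inputs are not replicated; (ii) no processing
element computes more than `n ^ (3 / 2) / min (2 ^ a) (11 ^ 3)` multiplicative terms; (iii) all
foldings on `2 ^ b` processing elements, `2 ≤ 2 ^ b < 2 ^ a`, belong to the class. -/
inductive MMClass {N : ℕ} : ℕ → Program N → Prop where
  | intro (a : ℕ) (P : Program N) (valid : P.Valid a) (correct : P.Correct)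
      (noReplication : P.NoReplication)
      (load : ∀ r < 2 ^ a, ((P.termsComputed r).ncard : ℝ) ≤ (N : ℝ) ^ 3 / min (2 ^ a) (11 ^ 3))
      (fold_mem : ∀ b, 1 ≤ b → b < a → MMClass b (P.fold (a - b))) :
      MMClass a P

end MMClass

/-! ### The recursive network-oblivious algorithm, `n = 4 ^ k`, on `n` virtual processors -/

section Algorithm

/-- `⌈(log₂ n) / 3⌉`, the number of levels of the recursion. -/
def mmDepth (k : ℕ) : ℕ := (2 * k + 2) / 3

/-- Memory cells. The `8 ^ i` subproblems of the recursion level `i` are numbered by `t`; each one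
multiplies two square matrices of dimension `2 ^ (k - i)`, and `(r, c)` is a position in them.
Cells `a`, `b`, `m` are for the entries of the factors and of the product, `part` with
`l ∈ {0, 1}` is for the two contributions to an entry of the product that come from the next
level, `tmp` is an auxiliary cell, and `dummy j` is a cell of the `j`-th virtual processor. -/
inductive MMCell where
  | a (i t r c : ℕ) : MMCell
  | b (i t r c : ℕ) : MMCell
  | m (i t r c : ℕ) : MMCell
  | part (i t l r c : ℕ) : MMCell
  | tmp (i t r c : ℕ) : MMCell
  | dummy (j : ℕ) : MMCell
deriving DecidableEq

/-- The virtual processor responsible for the position `(r, c)` of the subproblem `t` of level `i`.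
The subproblem owns a segment of `n / 8 ^ i` consecutive virtual processors, over which its
positions are spread evenly in row-major order, `2 ^ i` positions each. (If `8 ^ i > n`, which
happens on the last level only, `8 ^ i / n` subproblems share one virtual processor. The final
`%` has no effect on positions in range.) -/
def mmOwner (k i t r c : ℕ) : ℕ :=
  ((t * 4 ^ (k - i) + r * 2 ^ (k - i) + c) / 2 ^ i) % 4 ^ k

def mmHome (k : ℕ) : MMCell → ℕ
  | .a i t r c => mmOwner k i t r c
  | .b i t r c => mmOwner k i t r c
  | .m i t r c => mmOwner k i t r c
  | .part i t _ r c => mmOwner k i t r c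
  | .tmp i t r c => mmOwner k i t r c
  | .dummy j => j % 4 ^ k

def mmInit (k : ℕ) : MMCell → Option (Entry (2 ^ k))
  | .a 0 0 r c => if h : r < 2 ^ k ∧ c < 2 ^ k then some (.a ⟨r, h.1⟩ ⟨c, h.2⟩) else none
  | .b 0 0 r c => if h : r < 2 ^ k ∧ c < 2 ^ k then some (.b ⟨r, h.1⟩ ⟨c, h.2⟩) else none
  | _ => none

/-- In a superstep with label `3 * i`, for `j < n / 2 ^ (3 * i + 1)`, the `j`-th virtual
processor sends `2 ^ i` dummy messages to the `(j + n / 2 ^ (3 * i + 1))`-th one. -/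
def mmDummy (k i : ℕ) : List (MMCell × MMCell) :=
  (List.range (4 ^ k / 2 ^ (3 * i + 1))).flatMap fun j =>
    List.replicate (2 ^ i) (.dummy j, .dummy (j + 4 ^ k / 2 ^ (3 * i + 1)))

/-- Applies `f t h k' l r c` to all subproblems `t` of level `i`, all `h, k', l ∈ {0, 1}`
and all positions `(r, c)` of a quadrant. -/
def mmForAll {α : Type} (k i : ℕ) (f : ℕ → ℕ → ℕ → ℕ → ℕ → ℕ → List α) : List α :=
  (List.range (8 ^ i)).flatMap fun t =>
    (List.range 2).flatMap fun h => (List.range 2).flatMap fun k' => (List.range 2).flatMap fun l =>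
      (List.range (2 ^ (k - (i + 1)))).flatMap fun r =>
        (List.range (2 ^ (k - (i + 1)))).flatMap fun c => f t h k' l r c

/-- The distribution of the inputs on level `i`: the quadrants `A_{h l}` and `B_{l k'}` of the
subproblem `t` become the factors of its subproblem `(h, k', l)`, which has the number
`8 * t + (4 * h + 2 * k' + l)` on level `i + 1`. -/
def mmDown (k i : ℕ) : Superstep MMCell where
  label := 3 * i
  code := []
  msgs := (mmForAll k i fun t h k' l r c =>
      [(.a i t (h * 2 ^ (k - (i + 1)) + r) (l * 2 ^ (k - (i + 1)) + c),
          .a (i + 1) (8 * t + (4 * h + 2 * k' + l)) r c),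
        (.b i t (l * 2 ^ (k - (i + 1)) + r) (k' * 2 ^ (k - (i + 1)) + c),
          .b (i + 1) (8 * t + (4 * h + 2 * k' + l)) r c)])
    ++ mmDummy k i

/-- Local code that completes the products on level `i`: on the last level, the sequential
multiplication; on the other ones, the sum of the two contributions to each entry. -/
def mmCode (k i : ℕ) : List (Instr MMCell) :=
  (List.range (8 ^ i)).flatMap fun t => (List.range (2 ^ (k - i))).flatMap fun r =>
    (List.range (2 ^ (k - i))).flatMap fun c =>
      if i = mmDepth k then
        .zero (.m i t r c) :: (List.range (2 ^ (k - i))).flatMap fun s =>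
          [.mul (.tmp i t r c) (.a i t r s) (.b i t s c),
            .add (.m i t r c) (.m i t r c) (.tmp i t r c)]
      else [.add (.m i t r c) (.part i t 0 r c) (.part i t 1 r c)]

/-- The products of level `i + 1` are completed and collected on level `i`. -/
def mmUp (k i : ℕ) : Superstep MMCell where
  label := 3 * i
  code := mmCode k (i + 1)
  msgs := (mmForAll k i fun t h k' l r c =>
      [(.m (i + 1) (8 * t + (4 * h + 2 * k' + l)) r c,
          .part i t l (h * 2 ^ (k - (i + 1)) + r) (k' * 2 ^ (k - (i + 1)) + c))])
    ++ mmDummy k i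

/-- The last superstep, where the entries of the product are completed. -/
def mmFinal (k : ℕ) : Superstep MMCell where
  label := 0
  code := mmCode k 0
  msgs := mmDummy k 0

/-- The recursive network-oblivious algorithm for the `n`-MM problem, `n = 4 ^ k`, on `n` virtual
processors. The subproblems of one level are solved in parallel. -/
def mmProgram (k : ℕ) : Program (2 ^ k) where
  Cell := MMCell
  home := mmHome k
  init := mmInit k
  out i j := .m 0 0 i j
  steps := (List.range (mmDepth k)).map (mmDown k)
    ++ ((List.range (mmDepth k)).reverse.map (mmUp k) ++ [mmFinal k])

end Algorithm

end NetworkOblivious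

open NetworkOblivious

/-!
Lower bound: execute an algorithm of the class symbolically, in the free semiring over the entries
of `A` and `B`. A processing element that computes the term `A[i,k] B[k,j]` must store or receive
both factors, and every term of the product is computed by some processing element that stores or
sends a partial sum of the entry `(i, j)`. The Loomis-Whitney inequality therefore bounds the number
of terms for which a processing element is responsible by the numbers of entries that it stores,
sends and receives. As there is no replication and the load is balanced, on `2 ^ (3 * j + 1)`
processing elements the degrees sum up to at least a constant times `n / 4 ^ j`. Applied to the
foldings of an algorithm on `p` processing elements, this shows that `F^0 + ⋯ + F^(3 * j)` is at
least a constant times `2 ^ j * n / p`, and Abel summation with the non-increasing weights `g` turns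
these bounds into a constant times `n / p * ∑ j, 2 ^ j * g (3 * j)` for the communication time.

Upper bound: on `p` processors the `3i`-supersteps of the recursive algorithm have degree
`O(2 ^ i * n / p)`, which matches the weights above, and the latencies are absorbed by
`ℓ i ≤ K * n / p * g i`.
-/

namespace NetworkOblivious

section WordCoefficients

variable {R X : Type*} [CommSemiring R]

/-- The coefficient of the word `w` in an element of a free algebra. Over `R = ℕ` the free algebra
is the free semiring, in which the symbolic executions take place. -/
noncomputable def wordCoeff (w : FreeMonoid X) :
    FreeAlgebra R X →ₗ[R] R :=
  (FreeAlgebra.basisFreeMonoid R X).coord w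

theorem wordCoeff_apply (w : FreeMonoid X) (V : FreeAlgebra R X) :
    wordCoeff w V = (FreeAlgebra.equivMonoidAlgebraFreeMonoid V).coeff w :=
  rfl

theorem ext_wordCoeff {V W : FreeAlgebra R X}
    (h : ∀ w, wordCoeff w V = wordCoeff w W) : V = W :=
  (FreeAlgebra.basisFreeMonoid R X).ext_elem h

open Classical in
theorem wordCoeff_one (w : FreeMonoid X) :
    wordCoeff w (1 : FreeAlgebra R X) = if w = 1 then 1 else 0 := by
  simp only [wordCoeff_apply, map_one, MonoidAlgebra.one_def, MonoidAlgebra.coeff_single,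
    Finsupp.single_apply, eq_comm]

theorem equivMonoidAlgebraFreeMonoid_ι (x : X) :
    FreeAlgebra.equivMonoidAlgebraFreeMonoid (FreeAlgebra.ι R x) =
      MonoidAlgebra.single (FreeMonoid.of x) 1 := by
  simp [FreeAlgebra.equivMonoidAlgebraFreeMonoid, MonoidAlgebra.of_apply]

open Classical in
theorem wordCoeff_ι (x : X) (w : FreeMonoid X) :
    wordCoeff w (FreeAlgebra.ι R x) = if w = FreeMonoid.of x then 1 else 0 := by
  simp only [wordCoeff_apply, equivMonoidAlgebraFreeMonoid_ι, MonoidAlgebra.coeff_single,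
    Finsupp.single_apply, eq_comm]

open Classical in
theorem wordCoeff_ι_mul_ι (x y : X) (w : FreeMonoid X) :
    wordCoeff w (FreeAlgebra.ι R x * FreeAlgebra.ι R y) =
      if w = FreeMonoid.of x * FreeMonoid.of y then 1 else 0 := by
  simp only [wordCoeff_apply, map_mul, equivMonoidAlgebraFreeMonoid_ι,
    MonoidAlgebra.single_mul_single, mul_one, MonoidAlgebra.coeff_single, Finsupp.single_apply,
    eq_comm]

theorem exists_wordCoeff_ne_zero_of_mul {V W : FreeAlgebra R X}
    {w : FreeMonoid X} (h : wordCoeff w (V * W) ≠ 0) :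
    ∃ u v, u * v = w ∧ wordCoeff u V ≠ 0 ∧ wordCoeff v W ≠ 0 := by
  classical
  simp only [wordCoeff_apply, map_mul, MonoidAlgebra.coeff_mul, Finsupp.sum] at h
  obtain ⟨u, hu, h⟩ := Finset.exists_ne_zero_of_sum_ne_zero h
  obtain ⟨v, hv, h⟩ := Finset.exists_ne_zero_of_sum_ne_zero h
  exact ⟨u, v, by_contra fun hne => h (if_neg hne), Finsupp.mem_support_iff.1 hu,
    Finsupp.mem_support_iff.1 hv⟩

theorem wordCoeff_mul_wordCoeff_le (V W : FreeAlgebra ℕ X) (u v : FreeMonoid X) :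
    wordCoeff u V * wordCoeff v W ≤ wordCoeff (u * v) (V * W) := by
  classical
  by_cases hu : wordCoeff u V = 0
  · simp [hu]
  by_cases hv : wordCoeff v W = 0
  · simp [hv]
  simp only [wordCoeff_apply, map_mul, MonoidAlgebra.coeff_mul, Finsupp.sum] at hu hv ⊢
  refine le_trans ?_ (Finset.single_le_sum_of_canonicallyOrdered (Finsupp.mem_support_iff.2 hu))
  refine le_trans ?_ (Finset.single_le_sum_of_canonicallyOrdered (Finsupp.mem_support_iff.2 hv))
  rw [if_pos rfl]

theorem wordCoeff_le_mul_right (V : FreeAlgebra ℕ X) {W : FreeAlgebra ℕ X} {v : FreeMonoid X}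
    (hv : wordCoeff v W ≠ 0) (u : FreeMonoid X) : wordCoeff u V ≤ wordCoeff (u * v) (V * W) :=
  (Nat.le_mul_of_pos_right _ (Nat.pos_of_ne_zero hv)).trans (wordCoeff_mul_wordCoeff_le V W u v)

theorem wordCoeff_le_mul_left {V : FreeAlgebra ℕ X} (W : FreeAlgebra ℕ X) {u : FreeMonoid X}
    (hu : wordCoeff u V ≠ 0) (v : FreeMonoid X) : wordCoeff v W ≤ wordCoeff (u * v) (V * W) :=
  (Nat.le_mul_of_pos_left _ (Nat.pos_of_ne_zero hu)).trans (wordCoeff_mul_wordCoeff_le V W u v)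

theorem mul_eq_of_iff {u v : FreeMonoid X} {x : X} :
    u * v = FreeMonoid.of x ↔ u = 1 ∧ v = FreeMonoid.of x ∨ u = FreeMonoid.of x ∧ v = 1 :=
  List.append_eq_singleton_iff

theorem mul_eq_of_mul_of_iff {u v : FreeMonoid X} {x y : X} :
    u * v = FreeMonoid.of x * FreeMonoid.of y ↔
      u = 1 ∧ v = FreeMonoid.of x * FreeMonoid.of y ∨ u = FreeMonoid.of x ∧ v = FreeMonoid.of y ∨
        u = FreeMonoid.of x * FreeMonoid.of y ∧ v = 1 := by
  refine List.append_eq_cons_iff.trans (or_congr_right ⟨?_, ?_⟩)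
  · rintro ⟨u', hu, huv⟩
    rcases List.append_eq_singleton_iff.1 huv.symm with ⟨rfl, hv⟩ | ⟨rfl, hv⟩
    exacts [Or.inl ⟨hu, hv⟩, Or.inr ⟨hu, hv⟩]
  · rintro (⟨rfl, rfl⟩ | ⟨rfl, rfl⟩)
    exacts [⟨[], rfl, rfl⟩, ⟨[y], rfl, rfl⟩]

theorem of_mul_of_inj {x y x' y' : X} :
    FreeMonoid.of x * FreeMonoid.of y = FreeMonoid.of x' * FreeMonoid.of y' ↔ x = x' ∧ y = y' := by
  rw [← FreeMonoid.toList.injective.eq_iff]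
  simp

theorem of_mul_of_ne_of (x y z : X) : FreeMonoid.of x * FreeMonoid.of y ≠ FreeMonoid.of z := by
  rw [ne_eq, ← FreeMonoid.toList.injective.eq_iff]
  simp

theorem of_mul_of_ne_one (x y : X) : FreeMonoid.of x * FreeMonoid.of y ≠ 1 := by
  simp

theorem eq_ι_of_wordCoeff_le {V : FreeAlgebra ℕ X} {x : X}
    (hx : wordCoeff (FreeMonoid.of x) V ≠ 0)
    (hle : ∀ w, wordCoeff w V ≤ wordCoeff w (FreeAlgebra.ι ℕ x)) : V = FreeAlgebra.ι ℕ x := by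
  refine ext_wordCoeff fun w => (hle w).antisymm ?_
  rw [wordCoeff_ι]
  split_ifs with hw
  · exact hw ▸ Nat.one_le_iff_ne_zero.2 hx
  · exact Nat.zero_le _

theorem eq_ι_or_eq_ι_of_add_eq_ι {V W : FreeAlgebra ℕ X} {x : X} (h : V + W = FreeAlgebra.ι ℕ x) :
    V = FreeAlgebra.ι ℕ x ∨ W = FreeAlgebra.ι ℕ x := by
  have hx : wordCoeff (FreeMonoid.of x) V + wordCoeff (FreeMonoid.of x) W ≠ 0 := by
    simp [← map_add, h, wordCoeff_ι]
  by_cases hV : wordCoeff (FreeMonoid.of x) V = 0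
  · exact Or.inr (eq_ι_of_wordCoeff_le (by omega) fun w => by simp [← h])
  · exact Or.inl (eq_ι_of_wordCoeff_le hV fun w => by simp [← h])

theorem eq_ι_or_eq_ι_of_mul_eq_ι {V W : FreeAlgebra ℕ X} {x : X} (h : V * W = FreeAlgebra.ι ℕ x) :
    V = FreeAlgebra.ι ℕ x ∨ W = FreeAlgebra.ι ℕ x := by
  have hx : wordCoeff (FreeMonoid.of x) (V * W) ≠ 0 := by simp [h, wordCoeff_ι]
  obtain ⟨u, v, huv, hu, hv⟩ := exists_wordCoeff_ne_zero_of_mul hx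
  rcases mul_eq_of_iff.1 huv with ⟨rfl, rfl⟩ | ⟨rfl, rfl⟩
  · exact Or.inr (eq_ι_of_wordCoeff_le hv fun w => by simpa [h] using wordCoeff_le_mul_left W hu w)
  · exact Or.inl (eq_ι_of_wordCoeff_le hu fun w => by simpa [h] using wordCoeff_le_mul_right V hv w)

end WordCoefficients

section PartialSums

variable {N : ℕ}

/-- The word `A[i,k] B[k,j]`, whose coefficient counts how often this multiplicative term occurs in
a symbolic expression. -/
def termWord (i k j : Fin N) : FreeMonoid (Entry N) :=
  FreeMonoid.of (Entry.a i k) * FreeMonoid.of (Entry.b k j)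

/-- The entry `(i, j)` of the product of the two input matrices, as a symbolic expression. -/
noncomputable def symProduct (i j : Fin N) : FreeAlgebra ℕ (Entry N) :=
  ∑ k, FreeAlgebra.ι ℕ (Entry.a i k) * FreeAlgebra.ι ℕ (Entry.b k j)

/-- `V` is a sum of some of the terms of the entry `(i, j)` of the product, each taken at most
once, and `A[i,k] B[k,j]` is one of them. -/
structure IsPartialSum (i k j : Fin N) (V : FreeAlgebra ℕ (Entry N)) : Prop where
  le_symProduct : ∀ w, wordCoeff w V ≤ wordCoeff w (symProduct i j)
  ne_zero : wordCoeff (termWord i k j) V ≠ 0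

theorem termWord_inj {i k j i' k' j' : Fin N} :
    termWord i k j = termWord i' k' j' ↔ i = i' ∧ k = k' ∧ j = j' := by
  simp only [termWord, of_mul_of_inj, Entry.a.injEq, Entry.b.injEq]
  tauto

open Classical in
theorem wordCoeff_symProduct (i j : Fin N) (w : FreeMonoid (Entry N)) :
    wordCoeff w (symProduct i j) = if ∃ k, w = termWord i k j then 1 else 0 := by
  simp only [symProduct, map_sum, wordCoeff_ι_mul_ι]
  split_ifs with h
  · obtain ⟨k, rfl⟩ := h
    simp [termWord, of_mul_of_inj, Finset.sum_ite_eq]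
  · exact Finset.sum_eq_zero fun k _ => if_neg fun hk => h ⟨k, hk⟩

theorem wordCoeff_mul_of_symProduct (i k j : Fin N) (w : FreeMonoid (Entry N)) :
    wordCoeff (w * FreeMonoid.of (Entry.b k j)) (symProduct i j) =
      wordCoeff w (FreeAlgebra.ι ℕ (Entry.a i k)) := by
  classical
  rw [wordCoeff_symProduct, wordCoeff_ι]
  refine if_congr ⟨?_, fun hw => ⟨k, by rw [hw, termWord]⟩⟩ rfl rfl
  rintro ⟨k', hk'⟩
  rcases mul_eq_of_mul_of_iff.1 hk' with ⟨-, hb⟩ | ⟨ha, hb⟩ | ⟨-, hb⟩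
  · exact absurd hb.symm (of_mul_of_ne_of _ _ _)
  · obtain rfl : k = k' := by simpa using FreeMonoid.of_injective hb
    exact ha
  · exact absurd hb (FreeMonoid.of_ne_one _)

theorem wordCoeff_of_mul_symProduct (i k j : Fin N) (w : FreeMonoid (Entry N)) :
    wordCoeff (FreeMonoid.of (Entry.a i k) * w) (symProduct i j) =
      wordCoeff w (FreeAlgebra.ι ℕ (Entry.b k j)) := by
  classical
  rw [wordCoeff_symProduct, wordCoeff_ι]
  refine if_congr ⟨?_, fun hw => ⟨k, by rw [hw, termWord]⟩⟩ rfl rfl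
  rintro ⟨k', hk'⟩
  rcases mul_eq_of_mul_of_iff.1 hk' with ⟨ha, -⟩ | ⟨ha, hb⟩ | ⟨ha, -⟩
  · exact absurd ha (FreeMonoid.of_ne_one _)
  · obtain rfl : k = k' := by simpa using FreeMonoid.of_injective ha
    exact hb
  · exact absurd ha.symm (of_mul_of_ne_of _ _ _)

theorem isPartialSum_symProduct (i k j : Fin N) : IsPartialSum i k j (symProduct i j) where
  le_symProduct _ := le_rfl
  ne_zero := by
    rw [wordCoeff_symProduct, if_pos ⟨k, rfl⟩]
    exact one_ne_zero

theorem IsPartialSum.index_unique {i k j i' k' j' : Fin N} {V : FreeAlgebra ℕ (Entry N)}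
    (h : IsPartialSum i k j V) (h' : IsPartialSum i' k' j' V) : i = i' ∧ j = j' := by
  have hne : wordCoeff (termWord i k j) (symProduct i' j') ≠ 0 := fun h0 =>
    h.ne_zero (Nat.le_zero.1 (h0 ▸ h'.le_symProduct _))
  rw [wordCoeff_symProduct] at hne
  obtain ⟨k'', hk⟩ : ∃ k'', termWord i k j = termWord i' k'' j' := by simpa using hne
  obtain ⟨hi, -, hj⟩ := termWord_inj.1 hk
  exact ⟨hi, hj⟩

theorem IsPartialSum.of_le {i k j : Fin N} {V W : FreeAlgebra ℕ (Entry N)}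
    (h : IsPartialSum i k j V) (hle : ∀ w, wordCoeff w W ≤ wordCoeff w V)
    (hne : wordCoeff (termWord i k j) W ≠ 0) : IsPartialSum i k j W :=
  ⟨fun w => (hle w).trans (h.le_symProduct w), hne⟩

theorem not_isPartialSum_zero (i k j : Fin N) : ¬ IsPartialSum i k j 0 :=
  fun h => h.ne_zero (map_zero _)

theorem not_isPartialSum_one (i k j : Fin N) : ¬ IsPartialSum i k j 1 := fun h =>
  h.ne_zero ((wordCoeff_one _).trans (if_neg (of_mul_of_ne_one _ _)))

theorem not_isPartialSum_ι (i k j : Fin N) (x : Entry N) :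
    ¬ IsPartialSum i k j (FreeAlgebra.ι ℕ x) := fun h =>
  h.ne_zero ((wordCoeff_ι _ _).trans (if_neg (of_mul_of_ne_of _ _ _)))

theorem IsPartialSum.of_add {i k j : Fin N} {V W : FreeAlgebra ℕ (Entry N)}
    (h : IsPartialSum i k j (V + W)) : IsPartialSum i k j V ∨ IsPartialSum i k j W := by
  by_cases hV : wordCoeff (termWord i k j) V = 0
  · exact Or.inr (h.of_le (by simp) fun hW => h.ne_zero (by rw [map_add, hV, hW]))
  · exact Or.inl (h.of_le (by simp) hV)

theorem IsPartialSum.of_mul {i k j : Fin N} {V W : FreeAlgebra ℕ (Entry N)}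
    (h : IsPartialSum i k j (V * W)) : IsPartialSum i k j V ∨ IsPartialSum i k j W ∨
      (V = FreeAlgebra.ι ℕ (Entry.a i k) ∧ W = FreeAlgebra.ι ℕ (Entry.b k j)) := by
  obtain ⟨u, v, huv, hu, hv⟩ := exists_wordCoeff_ne_zero_of_mul h.ne_zero
  have hV := wordCoeff_le_mul_right V hv
  have hW := wordCoeff_le_mul_left W hu
  rcases mul_eq_of_mul_of_iff.1 huv with ⟨rfl, rfl⟩ | ⟨rfl, rfl⟩ | ⟨rfl, rfl⟩
  · exact Or.inr (Or.inl (h.of_le (by simpa using hW) hv))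
  · refine Or.inr (Or.inr
      ⟨eq_ι_of_wordCoeff_le hu fun w => ?_, eq_ι_of_wordCoeff_le hv fun w => ?_⟩)
    · exact ((hV w).trans (h.le_symProduct _)).trans_eq (wordCoeff_mul_of_symProduct i k j w)
    · exact ((hW w).trans (h.le_symProduct _)).trans_eq (wordCoeff_of_mul_symProduct i k j w)
  · exact Or.inl (h.of_le (by simpa using hV) hu)

end PartialSums

section Execution

variable {γ : Type} [DecidableEq γ] {R : Type} [Semiring R]

theorem execCode_append (m : γ → R) (l l' : List (Instr γ)) :
    execCode m (l ++ l') = execCode (execCode m l) l' := List.foldl_append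

theorem execSteps_append (m : γ → R) (l l' : List (Superstep γ)) :
    execSteps m (l ++ l') = execSteps (execSteps m l) l' := List.foldl_append

theorem forall_foldl_update {S : Type} {p : γ → S → Prop} {src : γ → S} {msgs : List (γ × γ)}
    {m : γ → S} (hm : ∀ c, p c (m c)) (hmsg : ∀ e ∈ msgs, p e.2 (src e.1)) (c : γ) :
    p c (msgs.foldl (fun m' e => Function.update m' e.2 (src e.1)) m c) := by
  induction msgs generalizing m with
  | nil => exact hm c
  | cons e l ih =>
    rw [List.forall_mem_cons] at hmsg
    exact ih ((Function.forall_update_iff m p).2 ⟨hmsg.1, fun c' _ => hm c'⟩) hmsg.2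

/-- The condition of `Program.Valid` on a local instruction: its operands and its result are in the
memory of the same processing element. -/
def Instr.IsLocal (home : γ → ℕ) : Instr γ → Prop
  | .zero _ => True
  | .one _ => True
  | .add d x y => home x = home d ∧ home y = home d
  | .mul d x y => home x = home d ∧ home y = home d

theorem Program.Valid.isLocal {N a : ℕ} {P : Program N} (hP : P.Valid a) {s : Superstep P.Cell}
    (hs : s ∈ P.steps) {I : Instr P.Cell} (hI : I ∈ s.code) : I.IsLocal P.home := by
  have hloc := hP.code_local s hs I hI
  cases I <;> exact hloc

end Execution

section Invariants

variable {N : ℕ} {R : Type} [Semiring R]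

/-- In the execution of `P` from the memory `m`, the processing element `r` multiplies a cell
with content `V` by a cell with content `W`. -/
def Program.Multiplies (P : Program N) (m : P.Cell → R) (r : ℕ) (V W : R) : Prop :=
  ∃ (before after : List (Superstep P.Cell)) (s : Superstep P.Cell)
    (pre post : List (Instr P.Cell)) (d x y : P.Cell),
    P.steps = before ++ s :: after ∧ s.code = pre ++ Instr.mul d x y :: post ∧ P.home d = r ∧
      execCode (execSteps m before) pre x = V ∧ execCode (execSteps m before) pre y = W

/-- In the execution of `P` from the memory `m`, the processing element `r` sends a message with
content `V` to another processing element `r'`. -/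
def Program.Transmits (P : Program N) (m : P.Cell → R) (r r' : ℕ) (V : R) : Prop :=
  r ≠ r' ∧ ∃ (before after : List (Superstep P.Cell)) (s : Superstep P.Cell) (e : P.Cell × P.Cell),
    P.steps = before ++ s :: after ∧ e ∈ s.msgs ∧ P.home e.1 = r ∧ P.home e.2 = r' ∧
      execCode (execSteps m before) s.code e.1 = V

/-- The property `p r V`, read as "the processing element `r` may store `V`", holds initially and
is preserved by every operation and every message in the execution of `P` from the memory `m`. -/
structure Program.IsInvariant (P : Program N) (m : P.Cell → R) (p : ℕ → R → Prop) : Prop where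
  init : ∀ c, p (P.home c) (m c)
  zero : ∀ r, p r 0
  one : ∀ r, p r 1
  add : ∀ r V W, p r V → p r W → p r (V + W)
  mul : ∀ r V W, P.Multiplies m r V W → p r V → p r W → p r (V * W)
  transmit : ∀ r r' V, P.Transmits m r r' V → p r V → p r' V

namespace Program.IsInvariant

variable {P : Program N} {m : P.Cell → R} {p : ℕ → R → Prop} {a : ℕ}

theorem execCode_of_execSteps (hp : P.IsInvariant m p) (hP : P.Valid a)
    {before after : List (Superstep P.Cell)} {s : Superstep P.Cell}
    (hsteps : P.steps = before ++ s :: after) (hbefore : ∀ c, p (P.home c) (execSteps m before c))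
    (pre post : List (Instr P.Cell)) (hcode : s.code = pre ++ post) :
    ∀ c, p (P.home c) (execCode (execSteps m before) pre c) := by
  induction pre using List.reverseRecOn generalizing post with
  | nil => exact hbefore
  | append_singleton l I ih =>
    rw [List.append_assoc, List.singleton_append] at hcode
    have ih := ih _ hcode
    have hI : I.IsLocal P.home := hP.isLocal (s := s) (by simp [hsteps]) (by simp [hcode])
    have hupdate : ∀ d V, p (P.home d) V → ∀ c, p (P.home c)
        (Function.update (execCode (execSteps m before) l) d V c) := fun d V hV =>
      (Function.forall_update_iff _ fun c V => p (P.home c) V).2 ⟨hV, fun c _ => ih c⟩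
    rw [execCode_append]
    cases I with
    | zero d => exact hupdate d 0 (hp.zero _)
    | one d => exact hupdate d 1 (hp.one _)
    | add d x y => exact hupdate d _ (hp.add _ _ _ (hI.1 ▸ ih x) (hI.2 ▸ ih y))
    | mul d x y =>
      exact hupdate d _ (hp.mul _ _ _ ⟨before, after, s, l, post, d, x, y, hsteps, hcode, rfl, rfl,
        rfl⟩ (hI.1 ▸ ih x) (hI.2 ▸ ih y))

theorem execSteps (hp : P.IsInvariant m p) (hP : P.Valid a)
    (before after : List (Superstep P.Cell)) (hsteps : P.steps = before ++ after) :
    ∀ c, p (P.home c) (execSteps m before c) := by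
  induction before using List.reverseRecOn generalizing after with
  | nil => exact hp.init
  | append_singleton l s ih =>
    rw [List.append_assoc, List.singleton_append] at hsteps
    have hcode := hp.execCode_of_execSteps hP hsteps (ih _ hsteps) s.code [] (by simp)
    intro c
    rw [execSteps_append]
    refine forall_foldl_update (p := fun c V => p (P.home c) V) hcode (fun e he => ?_) c
    by_cases hhome : P.home e.1 = P.home e.2
    · exact hhome ▸ hcode e.1
    · exact hp.transmit _ _ _ ⟨hhome, l, after, s, e, hsteps, he, rfl, rfl, rfl⟩ (hcode e.1)

theorem of_multiplies (hp : P.IsInvariant m p) (hP : P.Valid a) {r : ℕ} {V W : R}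
    (h : P.Multiplies m r V W) : p r V ∧ p r W := by
  obtain ⟨before, after, s, pre, post, d, x, y, hsteps, hcode, rfl, rfl, rfl⟩ := h
  have hmul := hp.execCode_of_execSteps hP hsteps (hp.execSteps hP _ _ hsteps) pre _ hcode
  have hloc : P.home x = P.home d ∧ P.home y = P.home d :=
    hP.isLocal (s := s) (I := .mul d x y) (by simp [hsteps]) (by simp [hcode])
  exact ⟨hloc.1 ▸ hmul x, hloc.2 ▸ hmul y⟩

end Program.IsInvariant

end Invariants

section MessageContents

variable {γ : Type} [DecidableEq γ] {R : Type} [Semiring R]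

/-- The contents of the messages selected by `sel`, listed in the order in which the supersteps
send them; a content occurs once for each message that carries it. -/
noncomputable def msgContents (sel : γ × γ → Bool) : (γ → R) → List (Superstep γ) → List R
  | _, [] => []
  | m, s :: l => ((s.msgs.filter sel).map fun e => execCode m s.code e.1) ++
      msgContents sel (s.exec m) l

theorem mem_msgContents {sel : γ × γ → Bool} {m : γ → R} {before after : List (Superstep γ)}
    {s : Superstep γ} {e : γ × γ} (he : e ∈ s.msgs) (hsel : sel e = true) :
    execCode (execSteps m before) s.code e.1 ∈ msgContents sel m (before ++ s :: after) := by
  induction before generalizing m with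
  | nil =>
    simp only [List.nil_append, msgContents, List.mem_append, List.mem_map, List.mem_filter]
    exact Or.inl ⟨e, ⟨he, hsel⟩, rfl⟩
  | cons s' l ih =>
    simp only [List.cons_append, msgContents, List.mem_append]
    exact Or.inr (ih (m := s'.exec m))

theorem length_msgContents (sel : γ × γ → Bool) (m : γ → R) (l : List (Superstep γ)) :
    (msgContents sel m l).length = (l.map fun s => s.msgs.countP sel).sum := by
  induction l generalizing m with
  | nil => rfl
  | cons s l ih => simp [msgContents, ih, List.countP_eq_length_filter]

variable {N : ℕ} (P : Program N)

/-- The contents, in the symbolic execution, of the messages that the processing element `r` sends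
to other processing elements. -/
noncomputable def Program.sent (r : ℕ) : List (FreeAlgebra ℕ (Entry N)) :=
  msgContents (fun e => P.home e.1 = r ∧ P.home e.2 ≠ r) P.symInit P.steps

/-- The contents, in the symbolic execution, of the messages that the processing element `r`
receives from other processing elements. -/
noncomputable def Program.received (r : ℕ) : List (FreeAlgebra ℕ (Entry N)) :=
  msgContents (fun e => P.home e.2 = r ∧ P.home e.1 ≠ r) P.symInit P.steps

/-- The sum of the degrees of all communication supersteps on `2 ^ a` processing elements. -/
def Program.totalDegree (a : ℕ) : ℕ := ∑ i ∈ Finset.range a, P.cumDegree a i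

variable {P} {a r r' : ℕ} {V : FreeAlgebra ℕ (Entry N)}

theorem Program.Transmits.mem_sent (h : P.Transmits P.symInit r r' V) : V ∈ P.sent r := by
  obtain ⟨hne, before, after, s, e, hsteps, he, rfl, rfl, rfl⟩ := h
  rw [Program.sent, hsteps]
  exact mem_msgContents he (by simpa using hne.symm)

theorem Program.Transmits.mem_received (h : P.Transmits P.symInit r r' V) : V ∈ P.received r' := by
  obtain ⟨hne, before, after, s, e, hsteps, he, rfl, rfl, rfl⟩ := h
  rw [Program.received, hsteps]
  exact mem_msgContents he (by simpa using hne)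

theorem sum_range_sum_map_filter_eq {β : Type*} (l : List β) (key f : β → ℕ) (a : ℕ) :
    ∑ i ∈ Finset.range a, ((l.filter fun s => key s = i).map f).sum =
      (l.map fun s => if key s < a then f s else 0).sum := by
  induction l with
  | nil => simp
  | cons s l ih =>
    have hcons : ∀ i, (((s :: l).filter fun s => key s = i).map f).sum =
        (if key s = i then f s else 0) + ((l.filter fun s => key s = i).map f).sum := fun i => by
      by_cases h : key s = i <;> simp [h]
    simp [hcons, Finset.sum_add_distrib, ih]

theorem Program.countP_sent_le_degree (hr : r < 2 ^ a) (s : Superstep P.Cell) :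
    s.msgs.countP (fun e => P.home e.1 = r ∧ P.home e.2 ≠ r) ≤ P.degree a s :=
  (le_max_left _ _).trans (Finset.le_sup (f := fun r =>
    max (s.msgs.countP fun e => P.home e.1 = r ∧ P.home e.2 ≠ r)
      (s.msgs.countP fun e => P.home e.2 = r ∧ P.home e.1 ≠ r)) (Finset.mem_range.2 hr))

theorem Program.countP_received_le_degree (hr : r < 2 ^ a) (s : Superstep P.Cell) :
    s.msgs.countP (fun e => P.home e.2 = r ∧ P.home e.1 ≠ r) ≤ P.degree a s :=
  (le_max_right _ _).trans (Finset.le_sup (f := fun r =>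
    max (s.msgs.countP fun e => P.home e.1 = r ∧ P.home e.2 ≠ r)
      (s.msgs.countP fun e => P.home e.2 = r ∧ P.home e.1 ≠ r)) (Finset.mem_range.2 hr))

theorem Program.Valid.home_eq_of_le_label (hP : P.Valid a) {s : Superstep P.Cell}
    (hs : s ∈ P.steps) (hl : a ≤ s.label) {e : P.Cell × P.Cell} (he : e ∈ s.msgs) :
    P.home e.1 = P.home e.2 := by
  simpa [Nat.sub_eq_zero_of_le hl] using hP.msgs_cluster s hs e he

theorem Program.Valid.sum_countP_le_totalDegree (hP : P.Valid a) {sel : P.Cell × P.Cell → Bool}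
    (hsel : ∀ e, sel e = true → P.home e.1 ≠ P.home e.2)
    (hdegree : ∀ s : Superstep P.Cell, s.msgs.countP sel ≤ P.degree a s) :
    (P.steps.map fun s => s.msgs.countP sel).sum ≤ P.totalDegree a := by
  rw [Program.totalDegree]
  refine le_of_le_of_eq (List.sum_le_sum fun s hs => ?_)
    (sum_range_sum_map_filter_eq P.steps Superstep.label (P.degree a) a).symm
  split_ifs with hl
  · exact hdegree s
  · refine (List.countP_eq_zero.2 fun e he h => hsel e h ?_).le
    exact hP.home_eq_of_le_label hs (not_lt.1 hl) he

theorem Program.Valid.length_sent_le (hP : P.Valid a) (hr : r < 2 ^ a) :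
    (P.sent r).length ≤ P.totalDegree a :=
  (length_msgContents _ _ _).trans_le <| hP.sum_countP_le_totalDegree
    (fun e he h => by simp_all) (Program.countP_sent_le_degree hr)

theorem Program.Valid.length_received_le (hP : P.Valid a) (hr : r < 2 ^ a) :
    (P.received r).length ≤ P.totalDegree a :=
  (length_msgContents _ _ _).trans_le <| hP.sum_countP_le_totalDegree
    (fun e he h => by simp_all) (Program.countP_received_le_degree hr)

end MessageContents

section InformationFlow

variable {N : ℕ} {P : Program N} {a r : ℕ}

/-- The processing element `r` stores the input entry `x` initially or receives it in a message. -/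
def Program.Obtains (P : Program N) (r : ℕ) (x : Entry N) : Prop :=
  (∃ c, P.home c = r ∧ P.init c = some x) ∨ FreeAlgebra.ι ℕ x ∈ P.received r

/-- The processing element `r` stores the entry `(i, j)` of the product at the end or sends a
partial sum of it. -/
def Program.Contributes (P : Program N) (r : ℕ) (i j : Fin N) : Prop :=
  P.home (P.out i j) = r ∨ ∃ V ∈ P.sent r, ∃ k, IsPartialSum i k j V

theorem Program.symInit_eq_zero_or_ι (c : P.Cell) :
    P.symInit c = 0 ∨ ∃ x, P.init c = some x ∧ P.symInit c = FreeAlgebra.ι ℕ x := by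
  simp only [Program.symInit, Program.initMem]
  cases h : P.init c with
  | none => exact Or.inl rfl
  | some x => exact Or.inr ⟨x, rfl, rfl⟩

theorem Program.isInvariant_obtains (P : Program N) (x : Entry N) :
    P.IsInvariant P.symInit fun r V => V = FreeAlgebra.ι ℕ x → P.Obtains r x where
  init c h := by
    rcases P.symInit_eq_zero_or_ι c with h0 | ⟨y, hy, hc⟩
    · exact absurd (h.symm.trans h0) (FreeAlgebra.ι_ne_zero x)
    · exact Or.inl ⟨c, rfl, FreeAlgebra.ι_injective (hc.symm.trans h) ▸ hy⟩
  zero _ h := absurd h.symm (FreeAlgebra.ι_ne_zero x)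
  one _ h := absurd h.symm (FreeAlgebra.ι_ne_one x)
  add _ _ _ hV hW h := (eq_ι_or_eq_ι_of_add_eq_ι h).elim hV hW
  mul _ _ _ _ hV hW h := (eq_ι_or_eq_ι_of_mul_eq_ι h).elim hV hW
  transmit _ _ _ hsend _ h := Or.inr (h ▸ hsend.mem_received)

theorem Program.Valid.obtains_of_mem_termsComputed (hP : P.Valid a) {i k j : Fin N}
    (h : (i, k, j) ∈ P.termsComputed r) : P.Obtains r (.a i k) ∧ P.Obtains r (.b k j) :=
  ⟨((P.isInvariant_obtains _).of_multiplies hP h).1 rfl,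
    ((P.isInvariant_obtains _).of_multiplies hP h).2 rfl⟩

/-- The multiplicative terms computed by `r` for which `r` is responsible: it contributes to the
entry of the product in which the term occurs. -/
def Program.ownTerms (P : Program N) (r : ℕ) : Set (Fin N × Fin N × Fin N) :=
  {τ ∈ P.termsComputed r | P.Contributes r τ.1 τ.2.2}

/- A partial sum that arises at `r'` contains a term that was computed at `r'` itself or at a
processing element from which a partial sum had to be sent. -/
theorem Program.isInvariant_isPartialSum (P : Program N) (i k j : Fin N) :
    P.IsInvariant P.symInit fun r' V => IsPartialSum i k j V →
      (i, k, j) ∈ P.termsComputed r' ∨ ∃ r, (i, k, j) ∈ P.ownTerms r where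
  init c h := by
    rcases P.symInit_eq_zero_or_ι c with h0 | ⟨y, -, hc⟩
    · exact absurd (h0 ▸ h) (not_isPartialSum_zero _ _ _)
    · exact absurd (hc ▸ h) (not_isPartialSum_ι _ _ _ _)
  zero _ h := absurd h (not_isPartialSum_zero _ _ _)
  one _ h := absurd h (not_isPartialSum_one _ _ _)
  add _ _ _ hV hW h := h.of_add.elim hV hW
  mul r V W hmul hV hW h := by
    rcases h.of_mul with h | h | ⟨rfl, rfl⟩
    exacts [hV h, hW h, Or.inl hmul]
  transmit r _ V hsend hV h := (hV h).elim
    (fun hr => Or.inr ⟨r, hr, Or.inr ⟨V, hsend.mem_sent, k, h⟩⟩) Or.inr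

theorem Program.Correct.symbolic (hC : P.Correct) (i j : Fin N) :
    execSteps P.symInit P.steps (P.out i j) = symProduct i j := by
  have hval : entryVal (Matrix.of fun i j => FreeAlgebra.ι ℕ (Entry.a i j))
      (Matrix.of fun i j => FreeAlgebra.ι ℕ (Entry.b i j)) = (FreeAlgebra.ι ℕ (X := Entry N)) := by
    funext x
    cases x <;> rfl
  rw [Program.symInit, ← hval, hC, Matrix.mul_apply]
  rfl

theorem Program.Valid.exists_mem_ownTerms (hP : P.Valid a) (hC : P.Correct)
    (τ : Fin N × Fin N × Fin N) : ∃ r < 2 ^ a, τ ∈ P.ownTerms r := by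
  obtain ⟨i, k, j⟩ := τ
  have hout := (P.isInvariant_isPartialSum i k j).execSteps hP P.steps [] (by simp) (P.out i j)
  rw [hC.symbolic] at hout
  obtain ⟨r, hr⟩ : ∃ r, (i, k, j) ∈ P.ownTerms r :=
    (hout (isPartialSum_symProduct i k j)).elim (fun h => ⟨_, h, Or.inl rfl⟩) id
  obtain ⟨_, _, _, _, _, d, _, _, _, _, rfl, _⟩ := hr.1
  exact ⟨_, hP.home_lt d, hr⟩

end InformationFlow

section Counting

open Finset

theorem sum_card_fiber_sq_le_card_mul_card {α β γ : Type*} [DecidableEq α] [DecidableEq β]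
    [DecidableEq γ] (T : Finset (α × β × γ)) (C : Finset (α × γ)) :
    ∑ x ∈ C, #{τ ∈ T | (τ.1, τ.2.2) = x} ^ 2 ≤
      #(T.image fun τ => (τ.1, τ.2.1)) * #(T.image fun τ => (τ.2.1, τ.2.2)) := by
  simp only [sq, ← card_product, ← card_sigma]
  refine card_le_card_of_injOn
    (fun y => ((y.2.1.1, y.2.1.2.1), (y.2.2.2.1, y.2.2.2.2))) ?_ ?_
  · rintro ⟨x, τ, τ'⟩ h
    simp only [coe_sigma, coe_product, Set.mem_sigma_iff, Set.mem_prod, mem_coe, mem_filter] at h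
    simp only [coe_product, Set.mem_prod, mem_coe]
    exact ⟨mem_image_of_mem _ h.2.1.1, mem_image_of_mem _ h.2.2.1⟩
  · rintro ⟨⟨x1, x2⟩, ⟨i, k, j⟩, ⟨i', k', j'⟩⟩ h ⟨⟨y1, y2⟩, ⟨u, v, w⟩, ⟨u', v', w'⟩⟩ h' heq
    simp only [coe_sigma, coe_product, Set.mem_sigma_iff, Set.mem_prod, mem_coe, mem_filter,
      Prod.mk.injEq] at h h' heq
    obtain ⟨_, ⟨_, rfl, rfl⟩, _, rfl, rfl⟩ := h
    obtain ⟨_, ⟨_, rfl, rfl⟩, _, rfl, rfl⟩ := h'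
    obtain ⟨⟨rfl, rfl⟩, rfl, rfl⟩ := heq
    rfl

/- The Loomis–Whitney inequality, by Cauchy–Schwarz over the fibres of the third projection. -/
theorem card_sq_le_card_projections {α β γ : Type*} [DecidableEq α] [DecidableEq β]
    [DecidableEq γ] (T : Finset (α × β × γ)) :
    #T ^ 2 ≤ #(T.image fun τ => (τ.1, τ.2.1)) * #(T.image fun τ => (τ.2.1, τ.2.2)) *
      #(T.image fun τ => (τ.1, τ.2.2)) := by
  set C := T.image fun τ => (τ.1, τ.2.2)
  have hfibers : #T = ∑ x ∈ C, #{τ ∈ T | (τ.1, τ.2.2) = x} :=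
    card_eq_sum_card_fiberwise fun τ hτ => mem_image_of_mem _ hτ
  calc #T ^ 2 = (∑ x ∈ C, #{τ ∈ T | (τ.1, τ.2.2) = x}) ^ 2 := by rw [hfibers]
    _ ≤ #C * ∑ x ∈ C, #{τ ∈ T | (τ.1, τ.2.2) = x} ^ 2 := by
        exact_mod_cast sq_sum_le_card_mul_sum_sq
    _ ≤ #C * _ := Nat.mul_le_mul_left _ (sum_card_fiber_sq_le_card_mul_card T C)
    _ = _ := Nat.mul_comm _ _

theorem card_le_card_add_length {α β : Type*} (s t : Finset α) (l : List β)
    {rel : α → β → Prop} (hrel : ∀ x y v, rel x v → rel y v → x = y)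
    (h : ∀ x ∈ s, x ∈ t ∨ ∃ v ∈ l, rel x v) : #s ≤ #t + l.length := by
  classical
  rw [← card_inter_add_card_sdiff s t]
  refine Nat.add_le_add (card_le_card inter_subset_right) (le_trans ?_ l.toFinset_card_le)
  refine card_le_card_of_forall_subsingleton rel (fun x hx => ?_) fun v _ x hx y hy =>
    hrel x y v hx.2 hy.2
  obtain ⟨hs, ht⟩ := mem_sdiff.1 hx
  obtain ⟨v, hv, hxv⟩ := (h x hs).resolve_left ht
  exact ⟨v, List.mem_toFinset.2 hv, hxv⟩

theorem sum_card_le_card_univ {ι α : Type*} [Fintype α] (s : Finset ι) (f : ι → Finset α)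
    (h : ∀ r r' x, x ∈ f r → x ∈ f r' → r = r') : ∑ r ∈ s, #(f r) ≤ Fintype.card α := by
  classical
  rw [← card_biUnion fun r _ r' _ hne => disjoint_left.2 fun x hx hx' => hne (h r r' x hx hx')]
  exact card_le_univ _

variable {N : ℕ} (P : Program N)

open Classical in
/-- The positions `q` of a matrix with entries `f q` such that the entry is initially stored by the
processing element `r`. -/
noncomputable def Program.inputsAt (f : Fin N × Fin N → Entry N) (r : ℕ) :
    Finset (Fin N × Fin N) :=
  {q | ∃ c, P.home c = r ∧ P.init c = some (f q)}

/-- The positions of the entries of the product that are finally stored by the processing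
element `r`. -/
def Program.outputsAt (r : ℕ) : Finset (Fin N × Fin N) := {q | P.home (P.out q.1 q.2) = r}

variable {P} {a r : ℕ}

theorem Program.mem_inputsAt {f : Fin N × Fin N → Entry N} {q : Fin N × Fin N} :
    q ∈ P.inputsAt f r ↔ ∃ c, P.home c = r ∧ P.init c = some (f q) := by
  simp [Program.inputsAt]

theorem Program.mem_outputsAt {q : Fin N × Fin N} :
    q ∈ P.outputsAt r ↔ P.home (P.out q.1 q.2) = r := by
  simp [Program.outputsAt]

theorem Program.NoReplication.sum_card_inputsAt_le (hP : P.NoReplication)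
    (f : Fin N × Fin N → Entry N) (s : Finset ℕ) : ∑ r ∈ s, #(P.inputsAt f r) ≤ N ^ 2 := by
  refine (sum_card_le_card_univ s _ fun r r' q h h' => ?_).trans_eq (by simp [sq])
  obtain ⟨c, rfl, hc⟩ := Program.mem_inputsAt.1 h
  obtain ⟨c', rfl, hc'⟩ := Program.mem_inputsAt.1 h'
  rw [hP c c' _ hc hc']

theorem Program.sum_card_outputsAt_le (P : Program N) (s : Finset ℕ) :
    ∑ r ∈ s, #(P.outputsAt r) ≤ N ^ 2 :=
  (sum_card_le_card_univ s _ fun _ _ _ h h' =>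
    (mem_outputsAt.1 h).symm.trans (mem_outputsAt.1 h')).trans_eq (by simp [sq])

theorem Program.Valid.card_le_of_obtains (hP : P.Valid a) (hr : r < 2 ^ a)
    {f : Fin N × Fin N → Entry N} (hf : Function.Injective f) {s : Finset (Fin N × Fin N)}
    (hs : ∀ q ∈ s, P.Obtains r (f q)) : #s ≤ #(P.inputsAt f r) + P.totalDegree a := by
  refine (card_le_card_add_length s (P.inputsAt f r) (P.received r)
    (rel := fun q V => V = FreeAlgebra.ι ℕ (f q)) (fun q q' V h h' =>
      hf (FreeAlgebra.ι_injective (h.symm.trans h'))) fun q hq => ?_).trans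
    (Nat.add_le_add_left (hP.length_received_le hr) _)
  exact (hs q hq).imp Program.mem_inputsAt.2 fun h => ⟨_, h, rfl⟩

theorem Program.Valid.card_le_of_contributes (hP : P.Valid a) (hr : r < 2 ^ a)
    {s : Finset (Fin N × Fin N)} (hs : ∀ q ∈ s, P.Contributes r q.1 q.2) :
    #s ≤ #(P.outputsAt r) + P.totalDegree a :=
  (card_le_card_add_length s (P.outputsAt r) (P.sent r)
    (fun _ _ _ ⟨_, h⟩ ⟨_, h'⟩ => Prod.ext_iff.2 (h.index_unique h')) fun q hq =>
      (hs q hq).imp_left Program.mem_outputsAt.2).trans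
    (Nat.add_le_add_left (hP.length_sent_le hr) _)

theorem Program.Valid.ncard_ownTerms_sq_le (hP : P.Valid a) (hr : r < 2 ^ a) :
    (P.ownTerms r).ncard ^ 2 ≤
      (#(P.inputsAt (fun q => .a q.1 q.2) r) + P.totalDegree a) *
      (#(P.inputsAt (fun q => .b q.1 q.2) r) + P.totalDegree a) *
      (#(P.outputsAt r) + P.totalDegree a) := by
  classical
  rw [Set.ncard_eq_toFinset_card']
  refine (card_sq_le_card_projections _).trans (Nat.mul_le_mul (Nat.mul_le_mul ?_ ?_) ?_)
  · refine hP.card_le_of_obtains hr (fun q q' h => by simpa [Prod.ext_iff] using h) ?_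
    simp only [forall_mem_image, Set.mem_toFinset]
    exact fun τ hτ => (hP.obtains_of_mem_termsComputed hτ.1).1
  · refine hP.card_le_of_obtains hr (fun q q' h => by simpa [Prod.ext_iff] using h) ?_
    simp only [forall_mem_image, Set.mem_toFinset]
    exact fun τ hτ => (hP.obtains_of_mem_termsComputed hτ.1).2
  · refine hP.card_le_of_contributes hr ?_
    simp only [forall_mem_image, Set.mem_toFinset]
    exact fun τ hτ => hτ.2

theorem Program.ncard_ownTerms_le (P : Program N) (r : ℕ) :
    (P.ownTerms r).ncard ≤ (P.termsComputed r).ncard :=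
  Set.ncard_le_ncard (Set.sep_subset _ _) (Set.toFinite _)

theorem Program.Valid.le_sum_ncard_ownTerms (hP : P.Valid a) (hC : P.Correct) :
    N ^ 3 ≤ ∑ r ∈ range (2 ^ a), (P.ownTerms r).ncard := by
  classical
  simp only [Set.ncard_eq_toFinset_card']
  have hcover : (univ : Finset (Fin N × Fin N × Fin N)) ⊆
      (range (2 ^ a)).biUnion fun r => (P.ownTerms r).toFinset := fun τ _ => by
    obtain ⟨r, hr, h⟩ := hP.exists_mem_ownTerms hC τ
    exact mem_biUnion.2 ⟨r, mem_range.2 hr, Set.mem_toFinset.2 h⟩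
  simpa [pow_succ, mul_assoc] using (card_le_card hcover).trans card_biUnion_le

end Counting

section WorkDistribution

/-- The numerical data of a multiplication of two `N × N` matrices by a set `s` of processing
elements with total degree at most `H`: `r` is responsible for `x r` multiplicative terms, it
initially stores `α r` and `β r` entries of the two factors, and it finally stores `γ r` entries of
the product. -/
structure IsWorkDistribution {ι : Type*} (s : Finset ι) (N H : ℝ) (x α β γ : ι → ℝ) : Prop where
  nonneg : ∀ r, 0 ≤ α r ∧ 0 ≤ β r ∧ 0 ≤ γ r
  sq_le : ∀ r ∈ s, x r ^ 2 ≤ (α r + H) * (β r + H) * (γ r + H)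
  le_sum : N ^ 3 ≤ ∑ r ∈ s, x r
  sum_α_le : ∑ r ∈ s, α r ≤ N ^ 2
  sum_β_le : ∑ r ∈ s, β r ≤ N ^ 2
  sum_γ_le : ∑ r ∈ s, γ r ≤ N ^ 2

theorem mul_mul_le_add_div_three_pow {x y z : ℝ} (hx : 0 ≤ x) (hy : 0 ≤ y) (hz : 0 ≤ z) :
    x * y * z ≤ ((x + y + z) / 3) ^ 3 := by
  nlinarith [mul_nonneg hx (sq_nonneg (y - z)), mul_nonneg hy (sq_nonneg (x - z)),
    mul_nonneg hz (sq_nonneg (x - y)), mul_nonneg (add_nonneg (add_nonneg hx hy) hz)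
      (add_nonneg (add_nonneg (sq_nonneg (x - y)) (sq_nonneg (y - z))) (sq_nonneg (x - z)))]

/- With `α = u²`, `β = v²`, `γ = w²` the first bound becomes `x ≤ (u + s) (v + s) (w + s)`. A rich
processing element, which holds `α ≥ N² / 100`, is bounded by its load; for a poor one the leading
term satisfies `u v w ≤ (N / 10) (v² + w²) / 2`. -/
theorem le_of_sq_le_of_load_le {N s H x α β γ : ℝ} (hN : 0 < N) (hs : 0 ≤ s) (hH : H ≤ s ^ 2)
    (hH₀ : 0 ≤ H) (hα : 0 ≤ α) (hβ : 0 ≤ β) (hγ : 0 ≤ γ)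
    (hx : x ^ 2 ≤ (α + H) * (β + H) * (γ + H)) (hload : x ≤ N ^ 3 / 1331) :
    x ≤ 100 / 1331 * N * α + N / 20 * (β + γ) + 5 / 2 * s * (α + β + γ) + 5 / 2 * s ^ 3 := by
  rcases le_or_gt (N ^ 2 / 100) α with hrich | hpoor
  · have hxα : x ≤ 100 / 1331 * N * α := by nlinarith
    have hrest : 0 ≤ N / 20 * (β + γ) + 5 / 2 * s * (α + β + γ) + 5 / 2 * s ^ 3 := by positivity
    linarith
  · obtain ⟨u, hu, rfl⟩ : ∃ u, 0 ≤ u ∧ u ^ 2 = α := ⟨√α, Real.sqrt_nonneg _, Real.sq_sqrt hα⟩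
    obtain ⟨v, hv, rfl⟩ : ∃ v, 0 ≤ v ∧ v ^ 2 = β := ⟨√β, Real.sqrt_nonneg _, Real.sq_sqrt hβ⟩
    obtain ⟨w, hw, rfl⟩ : ∃ w, 0 ≤ w ∧ w ^ 2 = γ := ⟨√γ, Real.sqrt_nonneg _, Real.sq_sqrt hγ⟩
    have hsq : ∀ {t : ℝ}, 0 ≤ t → t ^ 2 + H ≤ (t + s) ^ 2 := fun ht => by
      nlinarith [mul_nonneg ht hs]
    have hprod : x ≤ (u + s) * (v + s) * (w + s) := by
      refine le_of_sq_le_sq (hx.trans ?_) (by positivity)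
      rw [mul_pow, mul_pow]
      gcongr <;> exact hsq ‹_›
    have huN : u ≤ N / 10 := le_of_sq_le_sq (by linarith) (by positivity)
    have huvw : u * (v * w) ≤ N / 10 * ((v ^ 2 + w ^ 2) / 2) := by
      gcongr
      linarith [two_mul_le_add_sq v w]
    have hquadratic : s * (u * v + v * w + w * u) ≤ s * (u ^ 2 + v ^ 2 + w ^ 2) := by
      refine mul_le_mul_of_nonneg_left ?_ hs
      linarith [two_mul_le_add_sq u v, two_mul_le_add_sq v w, two_mul_le_add_sq w u]
    have hlinear : s * (s * (u + v + w)) ≤ s * ((3 * s ^ 2 + u ^ 2 + v ^ 2 + w ^ 2) / 2) := by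
      refine mul_le_mul_of_nonneg_left ?_ hs
      linarith [two_mul_le_add_sq s u, two_mul_le_add_sq s v, two_mul_le_add_sq s w]
    have hα' : 0 ≤ 100 / 1331 * N * u ^ 2 := by positivity
    have hrest : 0 ≤ s * (u ^ 2 + v ^ 2 + w ^ 2) := by positivity
    linarith

namespace IsWorkDistribution

variable {ι : Type*} {s : Finset ι} {N H : ℝ} {x α β γ : ι → ℝ}

theorem div_card_le (h : IsWorkDistribution s N H x α β γ) (hload : ∀ r ∈ s, x r ≤ N ^ 3 / s.card)
    {r : ι} (hr : r ∈ s) : N ^ 3 / s.card ≤ x r := by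
  by_contra! hlt
  have hcard : (s.card : ℝ) ≠ 0 := by exact_mod_cast (Finset.card_pos.2 ⟨r, hr⟩).ne'
  have hsum := Finset.sum_lt_sum hload ⟨r, hr, hlt⟩
  rw [Finset.sum_const, nsmul_eq_mul, mul_div_cancel₀ _ hcard] at hsum
  exact hsum.not_ge h.le_sum

/- Some processing element stores at most `3 N² / p` entries, and it must do its share
of `N³ / p` terms. -/
theorem sq_div_card_le (h : IsWorkDistribution s N H x α β γ) (hs : s.Nonempty) (hN : 0 ≤ N)
    (hH : 0 ≤ H) (hload : ∀ r ∈ s, x r ≤ N ^ 3 / s.card) :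
    (N ^ 3 / s.card) ^ 2 ≤ (N ^ 2 / s.card + H) ^ 3 := by
  have hcard : (s.card : ℝ) ≠ 0 := by exact_mod_cast hs.card_pos.ne'
  obtain ⟨r, hr, hle⟩ : ∃ r ∈ s, α r + β r + γ r ≤ 3 * (N ^ 2 / s.card) := by
    refine Finset.exists_le_of_sum_le hs ?_
    rw [Finset.sum_add_distrib, Finset.sum_add_distrib, Finset.sum_const, nsmul_eq_mul,
      mul_left_comm, mul_div_cancel₀ _ hcard]
    linarith [h.sum_α_le, h.sum_β_le, h.sum_γ_le]
  obtain ⟨hα, hβ, hγ⟩ := h.nonneg r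
  calc (N ^ 3 / s.card) ^ 2 ≤ x r ^ 2 :=
        pow_le_pow_left₀ (by positivity) (h.div_card_le hload hr) 2
    _ ≤ (α r + H) * (β r + H) * (γ r + H) := h.sq_le r hr
    _ ≤ ((α r + H + (β r + H) + (γ r + H)) / 3) ^ 3 :=
        mul_mul_le_add_div_three_pow (by positivity) (by positivity) (by positivity)
    _ ≤ (N ^ 2 / s.card + H) ^ 3 := pow_le_pow_left₀ (by positivity) (by linarith) 3

theorem lower_bound_of_card_le (h : IsWorkDistribution s N H x α β γ) (hN : 0 < N) (hH : 0 ≤ H)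
    (hcard₂ : 2 ≤ s.card) (hcard : s.card ≤ 1024) (hload : ∀ r ∈ s, x r ≤ N ^ 3 / s.card) :
    N ^ 2 / 8100 ≤ H := by
  by_contra! hlt
  have hp₂ : (2 : ℝ) ≤ s.card := by exact_mod_cast hcard₂
  have hp : (s.card : ℝ) ≤ 1024 := by exact_mod_cast hcard
  have hle := h.sq_div_card_le (Finset.card_pos.1 (by omega)) hN.le hH hload
  have hratio : (1 + (s.card : ℝ) / 8100) ^ 3 / s.card ≤ 1 := by
    rw [div_le_one (by linarith)]
    calc (1 + (s.card : ℝ) / 8100) ^ 3 ≤ (1 + 1024 / 8100) ^ 3 := by gcongr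
      _ ≤ 2 := by norm_num
      _ ≤ s.card := hp₂
  refine hle.not_gt ?_
  calc (N ^ 2 / s.card + H) ^ 3 < (N ^ 2 / s.card + N ^ 2 / 8100) ^ 3 :=
        pow_lt_pow_left₀ (by linarith) (by positivity) (by norm_num)
    _ = (N ^ 3 / s.card) ^ 2 * ((1 + s.card / 8100) ^ 3 / s.card) := by field_simp
    _ ≤ (N ^ 3 / s.card) ^ 2 := mul_le_of_le_one_right (by positivity) hratio

/- Summing `le_of_sq_le_of_load_le`, with `√H ≤ t ≤ N / 1440`, leaves less than `N³`. -/
theorem lt_of_load_le (h : IsWorkDistribution s N H x α β γ) (hN : 0 < N) (hH : 0 ≤ H) {t : ℝ}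
    (ht : 0 ≤ t) (htN : t ≤ N / 1440) (hst : s.card * t ^ 3 ≤ N ^ 3 / 1000)
    (hload : ∀ r ∈ s, x r ≤ N ^ 3 / 1331) : t ^ 2 < H := by
  by_contra! hHt
  refine h.le_sum.not_gt ((Finset.sum_le_sum fun r hr => le_of_sq_le_of_load_le hN ht hHt hH
    (h.nonneg r).1 (h.nonneg r).2.1 (h.nonneg r).2.2 (h.sq_le r hr) (hload r hr)).trans_lt ?_)
  simp only [Finset.sum_add_distrib, ← Finset.mul_sum, Finset.sum_const, nsmul_eq_mul]
  set A := ∑ r ∈ s, α r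
  set B := ∑ r ∈ s, β r
  set C := ∑ r ∈ s, γ r
  have hA : 0 ≤ A := Finset.sum_nonneg fun r _ => (h.nonneg r).1
  have hB : 0 ≤ B := Finset.sum_nonneg fun r _ => (h.nonneg r).2.1
  have hC : 0 ≤ C := Finset.sum_nonneg fun r _ => (h.nonneg r).2.2
  calc 100 / 1331 * N * A + N / 20 * (B + C) + 5 / 2 * t * (A + B + C) + 5 / 2 * (s.card * t ^ 3)
      ≤ 100 / 1331 * N * N ^ 2 + N / 20 * (N ^ 2 + N ^ 2)
        + 5 / 2 * (N / 1440) * (N ^ 2 + N ^ 2 + N ^ 2) + 5 / 2 * (N ^ 3 / 1000) := by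
        gcongr
        exacts [h.sum_α_le, h.sum_β_le, h.sum_γ_le, h.sum_α_le, h.sum_β_le, h.sum_γ_le]
    _ = (100 / 1331 + 1 / 10 + 1 / 192 + 1 / 400) * N ^ 3 := by ring
    _ < N ^ 3 := by nlinarith [pow_pos hN 3]

end IsWorkDistribution

theorem MMClass.ncard_ownTerms_le {N a : ℕ} {P : Program N} (hP : MMClass a P) {r : ℕ}
    (hr : r < 2 ^ a) : ((P.ownTerms r).ncard : ℝ) ≤ (N : ℝ) ^ 3 / min (2 ^ a) (11 ^ 3) := by
  obtain ⟨_, _, _, _, _, load, _⟩ := hP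
  exact le_trans (by exact_mod_cast P.ncard_ownTerms_le r) (load r hr)

theorem MMClass.isWorkDistribution {N a : ℕ} {P : Program N} (hP : MMClass a P) :
    IsWorkDistribution (Finset.range (2 ^ a)) N (P.totalDegree a)
      (fun r => (P.ownTerms r).ncard) (fun r => (P.inputsAt (fun q => .a q.1 q.2) r).card)
      (fun r => (P.inputsAt (fun q => .b q.1 q.2) r).card) (fun r => (P.outputsAt r).card) := by
  obtain ⟨_, _, valid, correct, noReplication, _, _⟩ := hP
  exact
    { nonneg := fun r => ⟨Nat.cast_nonneg _, Nat.cast_nonneg _, Nat.cast_nonneg _⟩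
      sq_le := fun r hr => by exact_mod_cast valid.ncard_ownTerms_sq_le (Finset.mem_range.1 hr)
      le_sum := by exact_mod_cast valid.le_sum_ncard_ownTerms correct
      sum_α_le := by exact_mod_cast noReplication.sum_card_inputsAt_le _ _
      sum_β_le := by exact_mod_cast noReplication.sum_card_inputsAt_le _ _
      sum_γ_le := by exact_mod_cast P.sum_card_outputsAt_le _ }

theorem MMClass.totalDegree_ge_of_le {N a : ℕ} {P : Program N} (hN : 0 < N) (ha₀ : 0 < a)
    (ha : a ≤ 10) (hP : MMClass a P) : (N : ℝ) ^ 2 / 8100 ≤ P.totalDegree a := by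
  have hp : 2 ^ a ≤ 2 ^ 10 := Nat.pow_le_pow_right two_pos ha
  refine hP.isWorkDistribution.lower_bound_of_card_le (by exact_mod_cast hN) (Nat.cast_nonneg _)
    ?_ (by simpa using hp) fun r hr => ?_
  · simpa using Nat.pow_le_pow_right two_pos ha₀
  · have hmin : min ((2 : ℝ) ^ a) (11 ^ 3) = 2 ^ a :=
      min_eq_left ((by exact_mod_cast hp : (2 : ℝ) ^ a ≤ 2 ^ 10).trans (by norm_num))
    simpa [hmin] using hP.ncard_ownTerms_le (Finset.mem_range.1 hr)

theorem MMClass.totalDegree_ge_of_four_le {N j : ℕ} {P : Program N} (hN : 0 < N) (hj : 4 ≤ j)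
    (hP : MMClass (3 * j + 1) P) :
    (N : ℝ) ^ 2 / (8100 * 4 ^ j) ≤ P.totalDegree (3 * j + 1) := by
  have hN' : (0 : ℝ) < N := by exact_mod_cast hN
  have h16 : (2 : ℝ) ^ 4 ≤ 2 ^ j := pow_le_pow_right₀ one_le_two hj
  have h4 : (4 : ℝ) ^ j = (2 ^ j) ^ 2 := by rw [← pow_mul, mul_comm j, pow_mul]; norm_num
  have h8 : (2 : ℝ) ^ (3 * j + 1) = 2 * (2 ^ j) ^ 3 := by rw [pow_succ, mul_comm 3 j, pow_mul]; ring
  have hmin : min ((2 : ℝ) ^ (3 * j + 1)) (11 ^ 3) = 11 ^ 3 := by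
    refine min_eq_right ?_
    rw [h8]
    linarith [pow_le_pow_left₀ (by norm_num) h16 3]
  have hlt := hP.isWorkDistribution.lt_of_load_le hN' (Nat.cast_nonneg _)
    (t := N / (90 * 2 ^ j)) (by positivity) (by gcongr; linarith)
    (by rw [Finset.card_range, Nat.cast_pow, Nat.cast_ofNat, h8]; field_simp; norm_num)
    fun r hr => (hP.ncard_ownTerms_le (Finset.mem_range.1 hr)).trans_eq (by rw [hmin]; norm_num)
  refine le_of_eq_of_le ?_ hlt.le
  rw [h4, div_pow, mul_pow]
  norm_num

theorem MMClass.totalDegree_ge {N j : ℕ} {P : Program N} (hN : 0 < N)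
    (hP : MMClass (3 * j + 1) P) :
    (N : ℝ) ^ 2 / (8100 * 4 ^ j) ≤ P.totalDegree (3 * j + 1) := by
  rcases le_or_gt j 3 with hj | hj
  · refine le_trans ?_ (hP.totalDegree_ge_of_le hN (by omega) (by omega))
    gcongr
    exact le_mul_of_one_le_right (by norm_num) (one_le_pow₀ (by norm_num))
  · exact hP.totalDegree_ge_of_four_le hN hj

end WorkDistribution

section Folding

variable {N : ℕ} {P : Program N}

theorem countP_le_sum_countP {α ι : Type*} {s : Finset ι} {l : List α} {p : α → Bool}
    {q : ι → α → Bool} (h : ∀ e ∈ l, p e → ∃ i ∈ s, q i e) :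
    l.countP p ≤ ∑ i ∈ s, l.countP (q i) := by
  induction l with
  | nil => simp
  | cons e l ih =>
    simp only [List.countP_cons, Finset.sum_add_distrib]
    refine Nat.add_le_add (ih fun e he => h e (List.mem_cons_of_mem _ he)) ?_
    split_ifs with hp
    · obtain ⟨i, hi, hq⟩ := h e List.mem_cons_self hp
      refine le_trans ?_ (Finset.single_le_sum (fun _ _ => Nat.zero_le _) hi)
      simp [hq]
    · exact Nat.zero_le _

theorem Program.degree_fold_le (P : Program N) (b e : ℕ) (s : Superstep P.Cell) :
    (P.fold e).degree b s ≤ 2 ^ e * P.degree (b + e) s := by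
  refine Finset.sup_le fun r hr => ?_
  set block := Finset.Ico (r * 2 ^ e) (r * 2 ^ e + 2 ^ e)
  have hmem : ∀ x : ℕ, x / 2 ^ e = r → x ∈ block := by
    rintro x rfl
    exact Finset.mem_Ico.2 ⟨Nat.div_mul_le_self x _, Nat.lt_div_mul_add (Nat.two_pow_pos e)⟩
  have hlt : ∀ r' ∈ block, r' < 2 ^ (b + e) := fun r' hr' => by
    calc r' < (r + 1) * 2 ^ e := by rw [add_one_mul]; exact (Finset.mem_Ico.1 hr').2
      _ ≤ 2 ^ b * 2 ^ e := Nat.mul_le_mul_right _ (Finset.mem_range.1 hr)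
      _ = 2 ^ (b + e) := (pow_add _ _ _).symm
  have hsum : ∀ {c : ℕ → ℕ}, (∀ r' ∈ block, c r' ≤ P.degree (b + e) s) →
      ∑ r' ∈ block, c r' ≤ 2 ^ e * P.degree (b + e) s := fun hc =>
    (Finset.sum_le_sum hc).trans_eq (by simp [block])
  refine max_le ?_ ?_
  · refine (countP_le_sum_countP fun x _ hx => ?_).trans
      (hsum fun r' hr' => Program.countP_sent_le_degree (hlt r' hr') s)
    obtain ⟨hx₁, hx₂⟩ := of_decide_eq_true hx
    exact ⟨_, hmem _ hx₁, decide_eq_true ⟨rfl, fun h => hx₂ ((congrArg (· / 2 ^ e) h).trans hx₁)⟩⟩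
  · refine (countP_le_sum_countP fun x _ hx => ?_).trans
      (hsum fun r' hr' => Program.countP_received_le_degree (hlt r' hr') s)
    obtain ⟨hx₁, hx₂⟩ := of_decide_eq_true hx
    exact ⟨_, hmem _ hx₁, decide_eq_true ⟨rfl, fun h => hx₂ ((congrArg (· / 2 ^ e) h).trans hx₁)⟩⟩

theorem Program.cumDegree_fold_le (P : Program N) (b e i : ℕ) :
    (P.fold e).cumDegree b i ≤ 2 ^ e * P.cumDegree (b + e) i := by
  rw [Program.cumDegree, Program.cumDegree, ← List.sum_map_mul_left]
  exact List.sum_le_sum fun s _ => P.degree_fold_le b e s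

theorem Program.fold_zero (P : Program N) : P.fold 0 = P := by
  simp [Program.fold]

theorem Program.fold_fold (P : Program N) (e e' : ℕ) :
    (P.fold e).fold e' = P.fold (e + e') := by
  simp [Program.fold, Nat.div_div_eq_div_mul, pow_add]

theorem MMClass.fold {b e : ℕ} (hP : MMClass (b + e) P) (hb : 1 ≤ b) : MMClass b (P.fold e) := by
  rcases Nat.eq_zero_or_pos e with rfl | he
  · rwa [Program.fold_zero]
  · obtain ⟨_, _, _, _, _, _, hfold⟩ := hP
    simpa using hfold b hb (by omega)

theorem MMClass.sum_cumDegree_ge {a j : ℕ} (hN : 0 < N) (hP : MMClass a P)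
    (hj : 3 * j + 1 ≤ a) :
    (N : ℝ) ^ 2 / (8100 * 2 ^ a) * (2 * 2 ^ j)
      ≤ ∑ i ∈ Finset.range (3 * j + 1), (P.cumDegree a i : ℝ) := by
  obtain ⟨e, rfl⟩ := Nat.exists_eq_add_of_le hj
  have hfold : (P.fold e).totalDegree (3 * j + 1) ≤
      2 ^ e * ∑ i ∈ Finset.range (3 * j + 1), P.cumDegree (3 * j + 1 + e) i := by
    rw [Program.totalDegree, Finset.mul_sum]
    exact Finset.sum_le_sum fun i _ => P.cumDegree_fold_le _ _ i
  have hlower : (N : ℝ) ^ 2 / (8100 * 4 ^ j) ≤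
      2 ^ e * ∑ i ∈ Finset.range (3 * j + 1), (P.cumDegree (3 * j + 1 + e) i : ℝ) :=
    ((hP.fold (by omega)).totalDegree_ge hN).trans (by exact_mod_cast hfold)
  rw [← div_le_iff₀' (by positivity)] at hlower
  refine le_of_eq_of_le ?_ hlower
  have h4 : (4 : ℝ) ^ j = (2 ^ j) ^ 2 := by rw [← pow_mul, mul_comm j, pow_mul]; norm_num
  have h8 : (2 : ℝ) ^ (3 * j + 1 + e) = 2 * (2 ^ j) ^ 3 * 2 ^ e := by
    rw [pow_add, pow_succ, mul_comm 3 j, pow_mul]; ring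
  rw [h8, h4]
  field_simp

end Folding

section Weights

theorem sum_mul_le_sum_mul_of_antitone {a : ℕ} {W F g : ℕ → ℝ}
    (hWF : ∀ b ≤ a, ∑ i ∈ Finset.range b, W i ≤ ∑ i ∈ Finset.range b, F i)
    (hg : 0 ≤ g) (hanti : Antitone g) :
    ∑ i ∈ Finset.range a, W i * g i ≤ ∑ i ∈ Finset.range a, F i * g i := by
  have hpartial : ∀ b ≤ a, 0 ≤ ∑ i ∈ Finset.range b, (F i - W i) := fun b hb => by
    rw [Finset.sum_sub_distrib]
    exact sub_nonneg.2 (hWF b hb)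
  have hsub : ∑ i ∈ Finset.range a, (F i * g i - W i * g i) =
      ∑ i ∈ Finset.range a, g i • (F i - W i) :=
    Finset.sum_congr rfl fun i _ => by rw [smul_eq_mul]; ring
  rw [← sub_nonneg, ← Finset.sum_sub_distrib, hsub, Finset.sum_range_by_parts, sub_eq_add_neg,
    ← Finset.sum_neg_distrib]
  refine add_nonneg (mul_nonneg (hg _) (hpartial a le_rfl)) (Finset.sum_nonneg fun i hi => ?_)
  rw [← neg_smul, neg_sub]
  have hi' := Finset.mem_range.1 hi
  exact mul_nonneg (sub_nonneg.2 (hanti i.le_succ)) (hpartial _ (by omega))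

/-- The weight of the label `i` in the communication time of the recursive algorithm: up to a
constant factor, the supersteps with label `i` have the cumulative degree `labelWeight i * n / p`
on `p` processors. -/
noncomputable def labelWeight (i : ℕ) : ℝ := if 3 ∣ i then 2 ^ (i / 3) else 0

theorem labelWeight_nonneg (i : ℕ) : 0 ≤ labelWeight i := by
  unfold labelWeight; split_ifs <;> positivity

theorem sum_labelWeight_le_two_pow (j : ℕ) : ∑ i ∈ Finset.range (3 * j), labelWeight i ≤ 2 ^ j := by
  induction j with
  | zero => simp
  | succ j ih =>
    have h0 : labelWeight (3 * j) = 2 ^ j := by simp [labelWeight]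
    have h1 : labelWeight (3 * j + 1) = 0 := if_neg (by omega)
    have h2 : labelWeight (3 * j + 2) = 0 := if_neg (by omega)
    rw [Nat.mul_succ, Finset.sum_range_succ, Finset.sum_range_succ, Finset.sum_range_succ,
      h0, h1, h2, pow_succ]
    linarith

variable {N a : ℕ} {P : Program N}

theorem MMClass.sum_labelWeight_le (hN : 0 < N) (hP : MMClass a P) {b : ℕ} (hb : b ≤ a) :
    ∑ i ∈ Finset.range b, (N : ℝ) ^ 2 / (8100 * 2 ^ a) * labelWeight i ≤
      ∑ i ∈ Finset.range b, (P.cumDegree a i : ℝ) := by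
  rcases Nat.eq_zero_or_pos b with rfl | hb₀
  · simp
  obtain ⟨j, hj, hbj⟩ : ∃ j, 3 * j + 1 ≤ b ∧ b ≤ 3 * (j + 1) := ⟨(b - 1) / 3, by omega, by omega⟩
  have hweights : ∑ i ∈ Finset.range b, labelWeight i ≤ 2 * 2 ^ j :=
    calc ∑ i ∈ Finset.range b, labelWeight i
        ≤ ∑ i ∈ Finset.range (3 * (j + 1)), labelWeight i :=
          Finset.sum_le_sum_of_subset_of_nonneg (Finset.range_mono hbj)
            fun i _ _ => labelWeight_nonneg i
      _ ≤ 2 ^ (j + 1) := sum_labelWeight_le_two_pow _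
      _ = 2 * 2 ^ j := pow_succ' _ _
  calc ∑ i ∈ Finset.range b, (N : ℝ) ^ 2 / (8100 * 2 ^ a) * labelWeight i
      ≤ (N : ℝ) ^ 2 / (8100 * 2 ^ a) * (2 * 2 ^ j) := by rw [← Finset.mul_sum]; gcongr
    _ ≤ ∑ i ∈ Finset.range (3 * j + 1), (P.cumDegree a i : ℝ) :=
        hP.sum_cumDegree_ge hN (hj.trans hb)
    _ ≤ ∑ i ∈ Finset.range b, (P.cumDegree a i : ℝ) :=
        Finset.sum_le_sum_of_subset_of_nonneg (Finset.range_mono hj)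
          fun _ _ _ => Nat.cast_nonneg _

theorem MMClass.commTime_ge (hN : 0 < N) (hP : MMClass a P) {g ℓ : Fin a → ℝ}
    (hg : ∀ i, 0 ≤ g i) (hℓ : ∀ i, 0 ≤ ℓ i) (hanti : Antitone g) :
    (N : ℝ) ^ 2 / (8100 * 2 ^ a) * ∑ i : Fin a, labelWeight i * g i ≤ P.commTime a g ℓ := by
  let G : ℕ → ℝ := fun i => if h : i < a then g ⟨i, h⟩ else 0
  have hG : ∀ i : Fin a, G i = g i := fun i => by simp [G]
  have hG₀ : 0 ≤ G := fun i => by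
    by_cases h : i < a <;> simp [G, h, hg]
  have hG_anti : Antitone G := fun i i' hi => by
    by_cases h : i' < a
    · simpa [G, h, hi.trans_lt h] using hanti (Fin.mk_le_mk.2 hi)
    · simpa [G, h] using hG₀ i
  calc (N : ℝ) ^ 2 / (8100 * 2 ^ a) * ∑ i : Fin a, labelWeight i * g i
      = ∑ i ∈ Finset.range a, (N : ℝ) ^ 2 / (8100 * 2 ^ a) * labelWeight i * G i := by
        simp only [← Fin.sum_univ_eq_sum_range, hG, Finset.mul_sum, mul_assoc]
    _ ≤ ∑ i ∈ Finset.range a, (P.cumDegree a i : ℝ) * G i :=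
        sum_mul_le_sum_mul_of_antitone (fun b hb => hP.sum_labelWeight_le hN hb) hG₀ hG_anti
    _ = ∑ i : Fin a, (P.cumDegree a i : ℝ) * g i := by
        rw [← Fin.sum_univ_eq_sum_range (fun i => (P.cumDegree a i : ℝ) * G i)]
        simp only [hG]
    _ ≤ P.commTime a g ℓ := Finset.sum_le_sum fun i _ =>
        le_add_of_nonneg_right (mul_nonneg (Nat.cast_nonneg _) (hℓ i))

end Weights

section Destinations

variable {γ : Type} [DecidableEq γ] {R : Type} [Semiring R]

/-- The cell that an instruction overwrites. -/
def Instr.dest : Instr γ → γ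
  | .zero d => d
  | .one d => d
  | .add d _ _ => d
  | .mul d _ _ => d

theorem execCode_of_forall_dest_ne (m : γ → R) {code : List (Instr γ)} {y : γ}
    (h : ∀ I ∈ code, I.dest ≠ y) : execCode m code y = m y := by
  induction code generalizing m with
  | nil => rfl
  | cons I l ih =>
    rw [List.forall_mem_cons] at h
    refine (ih (I.exec m) h.2).trans ?_
    cases I <;> exact Function.update_of_ne h.1.symm _ _

theorem Superstep.exec_of_mem_msgs (m : γ → R) {s : Superstep γ} {e : γ × γ} (he : e ∈ s.msgs)
    (hsource : ∀ e' ∈ s.msgs, e'.2 = e.2 → e'.1 = e.1) :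
    s.exec m e.2 = execCode m s.code e.1 := by
  obtain ⟨l, l', hl⟩ := List.append_of_mem he
  rw [Superstep.exec, hl, List.foldl_append, List.foldl_cons]
  refine forall_foldl_update (p := fun c v => c = e.2 → v = execCode m s.code e.1)
    (fun c hc => ?_) (fun e' he' h => ?_) _ rfl
  · rw [hc, Function.update_self]
  · rw [hsource e' (by simp [hl, he']) h]

theorem Superstep.exec_of_forall_ne (m : γ → R) {s : Superstep γ} {y : γ}
    (h : ∀ e ∈ s.msgs, e.2 ≠ y) : s.exec m y = execCode m s.code y :=
  forall_foldl_update (p := fun c v => c = y → v = execCode m s.code y)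
    (fun _ hc => by rw [hc]) (fun e he hy => absurd hy (h e he)) _ rfl

end Destinations

section Indices

theorem eq_and_eq_of_mul_add_eq {x y u v M : ℕ} (hu : u < M) (hv : v < M)
    (h : x * M + u = y * M + v) : x = y ∧ u = v := by
  have hmod := congrArg (· % M) h
  simp only [Nat.mul_add_mod', Nat.mod_eq_of_lt hu, Nat.mod_eq_of_lt hv] at hmod
  subst hmod
  exact ⟨Nat.eq_of_mul_eq_mul_right (by omega) (Nat.add_right_cancel h), rfl⟩

theorem two_mul_le_three_mul_mmDepth (k : ℕ) : 2 * k ≤ 3 * mmDepth k := by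
  unfold mmDepth; omega

theorem mmDepth_le (k : ℕ) : mmDepth k ≤ k := by
  unfold mmDepth; omega

theorem lt_of_lt_mmDepth {k i : ℕ} (hi : i < mmDepth k) : i < k :=
  hi.trans_le (mmDepth_le k)

theorem three_mul_lt_of_lt_mmDepth {k i : ℕ} (hi : i < mmDepth k) : 3 * i < 2 * k := by
  unfold mmDepth at hi; omega

theorem two_pow_sub_eq_two_mul {k i : ℕ} (hi : i < k) : 2 ^ (k - i) = 2 * 2 ^ (k - (i + 1)) := by
  rw [← pow_succ']
  congr 1
  omega

/-- The triples `(t, r, c)` of a subproblem `t` of the recursion level `i` and a position `(r, c)`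
in its matrices. -/
def positions (k i : ℕ) : List (ℕ × ℕ × ℕ) :=
  List.range (8 ^ i) ×ˢ List.range (2 ^ (k - i)) ×ˢ List.range (2 ^ (k - i))

/-- The tuples `(t, h, k', l, r, c)` over which `mmForAll k i` ranges: the subproblem
`8 * t + (4 * h + 2 * k' + l)` of the level `i + 1` is the subproblem `(h, k', l)` of the
subproblem `t` of the level `i`, and `(r, c)` is a position in its matrices. -/
def quadrantPositions (k i : ℕ) : List (ℕ × ℕ × ℕ × ℕ × ℕ × ℕ) :=
  List.range (8 ^ i) ×ˢ List.range 2 ×ˢ List.range 2 ×ˢ List.range 2 ×ˢ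
    List.range (2 ^ (k - (i + 1))) ×ˢ List.range (2 ^ (k - (i + 1)))

variable {k i t h k' l r c : ℕ}

theorem mem_positions :
    (t, r, c) ∈ positions k i ↔ t < 8 ^ i ∧ r < 2 ^ (k - i) ∧ c < 2 ^ (k - i) := by
  simp only [positions, SProd.sprod, List.pair_mem_product, List.mem_range]

theorem mem_quadrantPositions : (t, h, k', l, r, c) ∈ quadrantPositions k i ↔
    t < 8 ^ i ∧ h < 2 ∧ k' < 2 ∧ l < 2 ∧ r < 2 ^ (k - (i + 1)) ∧ c < 2 ^ (k - (i + 1)) := by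
  simp only [quadrantPositions, SProd.sprod, List.pair_mem_product, List.mem_range]

theorem nodup_positions (k i : ℕ) : (positions k i).Nodup :=
  List.nodup_range.product (List.nodup_range.product List.nodup_range)

theorem nodup_quadrantPositions (k i : ℕ) : (quadrantPositions k i).Nodup :=
  List.nodup_range.product (List.nodup_range.product (List.nodup_range.product
    (List.nodup_range.product (List.nodup_range.product List.nodup_range))))

theorem mmForAll_eq_flatMap {α : Type} (k i : ℕ) (f : ℕ → ℕ → ℕ → ℕ → ℕ → ℕ → List α) :
    mmForAll k i f = (quadrantPositions k i).flatMap fun (t, h, k', l, r, c) =>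
      f t h k' l r c := by
  simp only [mmForAll, quadrantPositions, SProd.sprod, List.product, List.flatMap_assoc,
    List.flatMap_map]

theorem mul_two_pow_add_lt {u x : ℕ} (hi : i < k) (hu : u < 2) (hx : x < 2 ^ (k - (i + 1))) :
    u * 2 ^ (k - (i + 1)) + x < 2 ^ (k - i) := by
  rw [two_pow_sub_eq_two_mul hi]
  calc u * 2 ^ (k - (i + 1)) + x < (u + 1) * 2 ^ (k - (i + 1)) := by rw [add_one_mul]; omega
    _ ≤ 2 * 2 ^ (k - (i + 1)) := Nat.mul_le_mul_right _ hu

theorem quadrant_mem_positions {u v : ℕ} (hi : i < k) (hu : u < 2) (hv : v < 2)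
    (hq : (t, h, k', l, r, c) ∈ quadrantPositions k i) :
    (t, u * 2 ^ (k - (i + 1)) + r, v * 2 ^ (k - (i + 1)) + c) ∈ positions k i := by
  obtain ⟨ht, -, -, -, hr, hc⟩ := mem_quadrantPositions.1 hq
  exact mem_positions.2 ⟨ht, mul_two_pow_add_lt hi hu hr, mul_two_pow_add_lt hi hv hc⟩

theorem child_mem_positions (hq : (t, h, k', l, r, c) ∈ quadrantPositions k i) :
    (8 * t + (4 * h + 2 * k' + l), r, c) ∈ positions k (i + 1) := by
  obtain ⟨ht, hh, hk', hl, hr, hc⟩ := mem_quadrantPositions.1 hq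
  exact mem_positions.2 ⟨by rw [pow_succ]; omega, hr, hc⟩

theorem exists_mem_quadrantPositions_of_child (hp : (t, r, c) ∈ positions k (i + 1)) :
    ∃ t' h k' l, t = 8 * t' + (4 * h + 2 * k' + l) ∧
      (t', h, k', l, r, c) ∈ quadrantPositions k i := by
  obtain ⟨ht, hr, hc⟩ := mem_positions.1 hp
  rw [pow_succ] at ht
  exact ⟨t / 8, t / 4 % 2, t / 2 % 2, t % 2, by omega,
    mem_quadrantPositions.2 ⟨by omega, by omega, by omega, by omega, hr, hc⟩⟩

theorem exists_mem_quadrantPositions_of_quadrant (hi : i < k) (hp : (t, r, c) ∈ positions k i) :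
    ∃ h k' r' c', r = h * 2 ^ (k - (i + 1)) + r' ∧ c = k' * 2 ^ (k - (i + 1)) + c' ∧
      ∀ l < 2, (t, h, k', l, r', c') ∈ quadrantPositions k i := by
  obtain ⟨ht, hr, hc⟩ := mem_positions.1 hp
  have hM : 0 < 2 ^ (k - (i + 1)) := Nat.two_pow_pos _
  rw [two_pow_sub_eq_two_mul hi, mul_comm] at hr hc
  exact ⟨_, _, _, _, (Nat.div_add_mod' r _).symm, (Nat.div_add_mod' c _).symm, fun l hl =>
    mem_quadrantPositions.2 ⟨ht, Nat.div_lt_of_lt_mul hr, Nat.div_lt_of_lt_mul hc, hl,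
      Nat.mod_lt _ hM, Nat.mod_lt _ hM⟩⟩

theorem child_inj {t₁ h₁ k₁ l₁ t₂ h₂ k₂ l₂ r₁ c₁ r₂ c₂ : ℕ}
    (h₁q : (t₁, h₁, k₁, l₁, r₁, c₁) ∈ quadrantPositions k i)
    (h₂q : (t₂, h₂, k₂, l₂, r₂, c₂) ∈ quadrantPositions k i)
    (heq : 8 * t₁ + (4 * h₁ + 2 * k₁ + l₁) = 8 * t₂ + (4 * h₂ + 2 * k₂ + l₂)) :
    t₁ = t₂ ∧ h₁ = h₂ ∧ k₁ = k₂ ∧ l₁ = l₂ := by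
  have := mem_quadrantPositions.1 h₁q
  have := mem_quadrantPositions.1 h₂q
  omega

end Indices

section Messages

variable {k i : ℕ} {e : MMCell × MMCell}

theorem mem_mmForAll {α : Type} {f : ℕ → ℕ → ℕ → ℕ → ℕ → ℕ → List α} {x : α} :
    x ∈ mmForAll k i f ↔ ∃ t h k' l r c, (t, h, k', l, r, c) ∈ quadrantPositions k i ∧
      x ∈ f t h k' l r c := by
  simp only [mmForAll_eq_flatMap, List.mem_flatMap, Prod.exists]

theorem mem_mmDummy : e ∈ mmDummy k i ↔
    ∃ j < 4 ^ k / 2 ^ (3 * i + 1), e = (.dummy j, .dummy (j + 4 ^ k / 2 ^ (3 * i + 1))) := by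
  simp [mmDummy, List.mem_replicate]

theorem mem_mmDown_msgs : e ∈ (mmDown k i).msgs ↔
    (∃ t h k' l r c, (t, h, k', l, r, c) ∈ quadrantPositions k i ∧
      (e = (.a i t (h * 2 ^ (k - (i + 1)) + r) (l * 2 ^ (k - (i + 1)) + c),
          .a (i + 1) (8 * t + (4 * h + 2 * k' + l)) r c) ∨
        e = (.b i t (l * 2 ^ (k - (i + 1)) + r) (k' * 2 ^ (k - (i + 1)) + c),
          .b (i + 1) (8 * t + (4 * h + 2 * k' + l)) r c))) ∨
      e ∈ mmDummy k i := by
  simp only [mmDown, List.mem_append, mem_mmForAll, List.mem_cons, List.not_mem_nil, or_false]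

theorem mem_mmUp_msgs : e ∈ (mmUp k i).msgs ↔
    (∃ t h k' l r c, (t, h, k', l, r, c) ∈ quadrantPositions k i ∧
      e = (.m (i + 1) (8 * t + (4 * h + 2 * k' + l)) r c,
        .part i t l (h * 2 ^ (k - (i + 1)) + r) (k' * 2 ^ (k - (i + 1)) + c))) ∨
      e ∈ mmDummy k i := by
  simp only [mmUp, List.mem_append, mem_mmForAll, List.mem_cons, List.not_mem_nil, or_false]

variable {R : Type} [Semiring R] (m : MMCell → R) {t h k' l r c : ℕ}

theorem mmDown_exec_a (hq : (t, h, k', l, r, c) ∈ quadrantPositions k i) :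
    (mmDown k i).exec m (.a (i + 1) (8 * t + (4 * h + 2 * k' + l)) r c) =
      m (.a i t (h * 2 ^ (k - (i + 1)) + r) (l * 2 ^ (k - (i + 1)) + c)) := by
  refine Superstep.exec_of_mem_msgs m (mem_mmDown_msgs.2 (.inl ⟨_, _, _, _, _, _, hq, .inl rfl⟩))
    fun e he hdest => ?_
  rcases mem_mmDown_msgs.1 he with ⟨t', h', k'', l', r', c', hq', rfl | rfl⟩ | hdummy
  · simp only [MMCell.a.injEq, true_and] at hdest
    obtain ⟨hchild, rfl, rfl⟩ := hdest
    obtain ⟨rfl, rfl, rfl, rfl⟩ := child_inj hq' hq hchild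
    rfl
  · simp at hdest
  · obtain ⟨j, -, rfl⟩ := mem_mmDummy.1 hdummy
    simp at hdest

theorem mmDown_exec_b (hq : (t, h, k', l, r, c) ∈ quadrantPositions k i) :
    (mmDown k i).exec m (.b (i + 1) (8 * t + (4 * h + 2 * k' + l)) r c) =
      m (.b i t (l * 2 ^ (k - (i + 1)) + r) (k' * 2 ^ (k - (i + 1)) + c)) := by
  refine Superstep.exec_of_mem_msgs m (mem_mmDown_msgs.2 (.inl ⟨_, _, _, _, _, _, hq, .inr rfl⟩))
    fun e he hdest => ?_
  rcases mem_mmDown_msgs.1 he with ⟨t', h', k'', l', r', c', hq', rfl | rfl⟩ | hdummy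
  · simp at hdest
  · simp only [MMCell.b.injEq, true_and] at hdest
    obtain ⟨hchild, rfl, rfl⟩ := hdest
    obtain ⟨rfl, rfl, rfl, rfl⟩ := child_inj hq' hq hchild
    rfl
  · obtain ⟨j, -, rfl⟩ := mem_mmDummy.1 hdummy
    simp at hdest

theorem mmUp_exec_part (hq : (t, h, k', l, r, c) ∈ quadrantPositions k i) :
    (mmUp k i).exec m (.part i t l (h * 2 ^ (k - (i + 1)) + r) (k' * 2 ^ (k - (i + 1)) + c)) =
      execCode m (mmCode k (i + 1)) (.m (i + 1) (8 * t + (4 * h + 2 * k' + l)) r c) := by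
  refine Superstep.exec_of_mem_msgs m (mem_mmUp_msgs.2 (.inl ⟨_, _, _, _, _, _, hq, rfl⟩))
    fun e he hdest => ?_
  rcases mem_mmUp_msgs.1 he with ⟨t', h', k'', l', r', c', hq', rfl⟩ | hdummy
  · obtain ⟨-, -, -, -, hr, hc⟩ := mem_quadrantPositions.1 hq
    obtain ⟨-, -, -, -, hr', hc'⟩ := mem_quadrantPositions.1 hq'
    simp only [MMCell.part.injEq, true_and] at hdest
    obtain ⟨rfl, rfl, hrow, hcol⟩ := hdest
    obtain ⟨rfl, rfl⟩ := eq_and_eq_of_mul_add_eq hr' hr hrow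
    obtain ⟨rfl, rfl⟩ := eq_and_eq_of_mul_add_eq hc' hc hcol
    rfl
  · obtain ⟨j, -, rfl⟩ := mem_mmDummy.1 hdummy
    simp at hdest

end Messages

section Subproblems

variable {R : Type} {k i t h k' l : ℕ} {f g : ℕ → ℕ → R}

/-- The entry at `(r, c)` of the left factor of the subproblem `t` of level `i`, when `f` is the
left factor on level `0`. The binary digits of `t % 8` say which quadrant of the left factor of
the subproblem `t / 8` it is. -/
def leftFactor (k : ℕ) (f : ℕ → ℕ → R) : ℕ → ℕ → ℕ → ℕ → R
  | 0, _, r, c => f r c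
  | i + 1, t, r, c => leftFactor k f i (t / 8) (t / 4 % 2 * 2 ^ (k - (i + 1)) + r)
      (t % 2 * 2 ^ (k - (i + 1)) + c)

/-- The entry at `(r, c)` of the right factor of the subproblem `t` of level `i`, when `f` is the
right factor on level `0`; see `leftFactor`. -/
def rightFactor (k : ℕ) (f : ℕ → ℕ → R) : ℕ → ℕ → ℕ → ℕ → R
  | 0, _, r, c => f r c
  | i + 1, t, r, c => rightFactor k f i (t / 8) (t % 2 * 2 ^ (k - (i + 1)) + r)
      (t / 2 % 2 * 2 ^ (k - (i + 1)) + c)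

theorem leftFactor_child (hh : h < 2) (hk' : k' < 2) (hl : l < 2) (r c : ℕ) :
    leftFactor k f (i + 1) (8 * t + (4 * h + 2 * k' + l)) r c =
      leftFactor k f i t (h * 2 ^ (k - (i + 1)) + r) (l * 2 ^ (k - (i + 1)) + c) := by
  rw [leftFactor, show (8 * t + (4 * h + 2 * k' + l)) / 8 = t by omega,
    show (8 * t + (4 * h + 2 * k' + l)) / 4 % 2 = h by omega,
    show (8 * t + (4 * h + 2 * k' + l)) % 2 = l by omega]

theorem rightFactor_child (hh : h < 2) (hk' : k' < 2) (hl : l < 2) (r c : ℕ) :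
    rightFactor k f (i + 1) (8 * t + (4 * h + 2 * k' + l)) r c =
      rightFactor k f i t (l * 2 ^ (k - (i + 1)) + r) (k' * 2 ^ (k - (i + 1)) + c) := by
  rw [rightFactor, show (8 * t + (4 * h + 2 * k' + l)) / 8 = t by omega,
    show (8 * t + (4 * h + 2 * k' + l)) / 2 % 2 = k' by omega,
    show (8 * t + (4 * h + 2 * k' + l)) % 2 = l by omega]

variable [Semiring R]

/-- The entry at `(r, c)` of the product to be computed by the subproblem `t` of level `i`. -/
def subproduct (k : ℕ) (f g : ℕ → ℕ → R) (i t r c : ℕ) : R :=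
  ∑ s ∈ Finset.range (2 ^ (k - i)), leftFactor k f i t r s * rightFactor k g i t s c

theorem subproduct_quadrant (hi : i < k) (hh : h < 2) (hk' : k' < 2) (r c : ℕ) :
    subproduct k f g i t (h * 2 ^ (k - (i + 1)) + r) (k' * 2 ^ (k - (i + 1)) + c) =
      subproduct k f g (i + 1) (8 * t + (4 * h + 2 * k' + 0)) r c +
        subproduct k f g (i + 1) (8 * t + (4 * h + 2 * k' + 1)) r c := by
  simp only [subproduct, two_pow_sub_eq_two_mul hi, two_mul (2 ^ (k - (i + 1))),
    Finset.sum_range_add, leftFactor_child hh hk' zero_lt_two,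
    rightFactor_child hh hk' zero_lt_two, leftFactor_child hh hk' one_lt_two,
    rightFactor_child hh hk' one_lt_two, zero_mul, zero_add, one_mul]

end Subproblems

section LocalCode

/-- The cells that serve as operands of the local code of some level without being changed by it. -/
def MMCell.IsOperand : MMCell → Prop
  | .a .. | .b .. | .part .. => True
  | .m .. | .tmp .. | .dummy _ => False

/-- The code that adds the inner product of the first `n` entries of the row `r` of the left factor
and of the column `c` of the right factor to the entry `(r, c)` of the product. -/
def innerProductCode (i t r c n : ℕ) : List (Instr MMCell) :=
  (List.range n).flatMap fun s =>
    [.mul (.tmp i t r c) (.a i t r s) (.b i t s c), .add (.m i t r c) (.m i t r c) (.tmp i t r c)]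

/-- The part of `mmCode k i` that completes the entry `(r, c)` of the subproblem `t`. -/
def mmEntryCode (k i t r c : ℕ) : List (Instr MMCell) :=
  if i = mmDepth k then .zero (.m i t r c) :: innerProductCode i t r c (2 ^ (k - i))
  else [.add (.m i t r c) (.part i t 0 r c) (.part i t 1 r c)]

variable {k i t r c : ℕ} {I : Instr MMCell}

theorem mmCode_eq_flatMap (k i : ℕ) :
    mmCode k i = (positions k i).flatMap fun (t, r, c) => mmEntryCode k i t r c := by
  simp only [mmCode, positions, SProd.sprod, List.product, List.flatMap_assoc, List.flatMap_map]
  rfl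

theorem mem_mmCode : I ∈ mmCode k i ↔
    ∃ t r c, (t, r, c) ∈ positions k i ∧ I ∈ mmEntryCode k i t r c := by
  simp only [mmCode_eq_flatMap, List.mem_flatMap, Prod.exists]

theorem mem_innerProductCode {n : ℕ} : I ∈ innerProductCode i t r c n ↔
    ∃ s < n, I = .mul (.tmp i t r c) (.a i t r s) (.b i t s c) ∨
      I = .add (.m i t r c) (.m i t r c) (.tmp i t r c) := by
  simp only [innerProductCode, List.mem_flatMap, List.mem_range, List.mem_cons, List.not_mem_nil,
    or_false]

theorem dest_of_mem_mmEntryCode (hI : I ∈ mmEntryCode k i t r c) :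
    I.dest = .m i t r c ∨ I.dest = .tmp i t r c := by
  unfold mmEntryCode at hI
  split_ifs at hI
  · rcases List.mem_cons.1 hI with rfl | hI
    · exact .inl rfl
    · obtain ⟨s, -, rfl | rfl⟩ := mem_innerProductCode.1 hI
      · exact .inr rfl
      · exact .inl rfl
  · rw [List.mem_singleton.1 hI]
    exact .inl rfl

theorem not_isOperand_dest (hI : I ∈ mmCode k i) : ¬ I.dest.IsOperand := by
  obtain ⟨t, r, c, -, hI⟩ := mem_mmCode.1 hI
  rcases dest_of_mem_mmEntryCode hI with hdest | hdest <;> simp [hdest, MMCell.IsOperand]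

variable {R : Type} [Semiring R] (m : MMCell → R)

theorem execCode_of_isOperand {code : List (Instr MMCell)} (hcode : code ⊆ mmCode k i)
    {y : MMCell} (hy : y.IsOperand) : execCode m code y = m y :=
  execCode_of_forall_dest_ne m fun _ hI hdest => not_isOperand_dest (hcode hI) (hdest ▸ hy)

theorem execCode_innerProductCode (i t r c n : ℕ) :
    execCode m (innerProductCode i t r c n) (.m i t r c) =
      m (.m i t r c) + ∑ s ∈ Finset.range n, m (.a i t r s) * m (.b i t s c) := by
  induction n with
  | zero => simp [innerProductCode, execCode]
  | succ n ih =>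
    have hkeep : ∀ y, y ≠ .m i t r c → y ≠ .tmp i t r c →
        execCode m (innerProductCode i t r c n) y = m y := fun y hm htmp =>
      execCode_of_forall_dest_ne m fun I hI => by
        obtain ⟨s, -, rfl | rfl⟩ := mem_innerProductCode.1 hI
        · exact htmp.symm
        · exact hm.symm
    rw [Finset.sum_range_succ, ← add_assoc, ← ih, ← hkeep (.a i t r n) (by simp) (by simp),
      ← hkeep (.b i t n c) (by simp) (by simp), innerProductCode, List.range_succ,
      List.flatMap_append, execCode_append, ← innerProductCode]
    generalize execCode m (innerProductCode i t r c n) = m'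
    simp [execCode, Instr.exec]

end LocalCode

section Correctness

variable {R : Type} [Semiring R]

/-- The cells for the factors of the subproblems of level `i` hold the right entries. -/
def FactorsReady (k : ℕ) (f g : ℕ → ℕ → R) (i : ℕ) (m : MMCell → R) : Prop :=
  ∀ t r c, (t, r, c) ∈ positions k i →
    m (.a i t r c) = leftFactor k f i t r c ∧ m (.b i t r c) = rightFactor k g i t r c

/-- The operands of `mmCode k i` hold the right entries: the factors on the last level, the
contributions of the next level on the other ones. -/
def OperandsReady (k : ℕ) (f g : ℕ → ℕ → R) (i : ℕ) (m : MMCell → R) : Prop :=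
  if i = mmDepth k then FactorsReady k f g i m else
    ∀ t h k' l r c, (t, h, k', l, r, c) ∈ quadrantPositions k i →
      m (.part i t l (h * 2 ^ (k - (i + 1)) + r) (k' * 2 ^ (k - (i + 1)) + c)) =
        subproduct k f g (i + 1) (8 * t + (4 * h + 2 * k' + l)) r c

variable {k i : ℕ} {f g : ℕ → ℕ → R} {m : MMCell → R}

theorem FactorsReady.mmDown_exec (hi : i < k) (hm : FactorsReady k f g i m) :
    FactorsReady k f g (i + 1) ((mmDown k i).exec m) := by
  intro t r c hp
  obtain ⟨t, h, k', l, rfl, hq⟩ := exists_mem_quadrantPositions_of_child hp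
  obtain ⟨-, hh, hk', hl, -, -⟩ := mem_quadrantPositions.1 hq
  rw [mmDown_exec_a m hq, mmDown_exec_b m hq, leftFactor_child hh hk' hl,
    rightFactor_child hh hk' hl]
  exact ⟨(hm _ _ _ (quadrant_mem_positions hi hh hl hq)).1,
    (hm _ _ _ (quadrant_mem_positions hi hl hk' hq)).2⟩

theorem FactorsReady.execSteps_mmDown {n : ℕ} (hn : n ≤ k) (hm : FactorsReady k f g 0 m) :
    FactorsReady k f g n (execSteps m ((List.range n).map (mmDown k))) := by
  induction n with
  | zero => exact hm
  | succ n ih =>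
    rw [List.range_succ, List.map_append, execSteps_append]
    exact (ih (by omega)).mmDown_exec (by omega)

theorem OperandsReady.congr {m' : MMCell → R} (hm : OperandsReady k f g i m)
    (h : ∀ y : MMCell, y.IsOperand → m' y = m y) : OperandsReady k f g i m' := by
  unfold OperandsReady at hm ⊢
  split_ifs at hm ⊢
  · intro t r c hp
    rw [h (.a ..) trivial, h (.b ..) trivial]
    exact hm t r c hp
  · intro t u v l r c hq
    rw [h (.part ..) trivial]
    exact hm t u v l r c hq

theorem OperandsReady.execCode_mmEntryCode (hi : i ≤ mmDepth k) (hm : OperandsReady k f g i m)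
    {t r c : ℕ} (hp : (t, r, c) ∈ positions k i) :
    execCode m (mmEntryCode k i t r c) (.m i t r c) = subproduct k f g i t r c := by
  unfold OperandsReady at hm
  unfold mmEntryCode
  split_ifs at hm ⊢ with hlast
  · obtain ⟨ht, hr, hc⟩ := mem_positions.1 hp
    refine (execCode_innerProductCode _ i t r c _).trans ?_
    simp only [Instr.exec, Function.update_self, zero_add, ne_eq, reduceCtorEq, not_false_eq_true,
      Function.update_of_ne]
    refine Finset.sum_congr rfl fun s hs => ?_
    have hs := Finset.mem_range.1 hs
    rw [(hm t r s (mem_positions.2 ⟨ht, hr, hs⟩)).1, (hm t s c (mem_positions.2 ⟨ht, hs, hc⟩)).2]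
  · have hik := lt_of_lt_mmDepth (lt_of_le_of_ne hi hlast)
    obtain ⟨h, k', r, c, rfl, rfl, hq⟩ := exists_mem_quadrantPositions_of_quadrant hik hp
    obtain ⟨-, hh, hk', -, -, -⟩ := mem_quadrantPositions.1 (hq 0 zero_lt_two)
    rw [subproduct_quadrant hik hh hk', ← hm t h k' 0 r c (hq 0 zero_lt_two),
      ← hm t h k' 1 r c (hq 1 one_lt_two)]
    simp [execCode, Instr.exec]

theorem OperandsReady.execCode_mmCode (hi : i ≤ mmDepth k) (hm : OperandsReady k f g i m)
    {t r c : ℕ} (hp : (t, r, c) ∈ positions k i) :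
    execCode m (mmCode k i) (.m i t r c) = subproduct k f g i t r c := by
  obtain ⟨before, after, hsplit⟩ := List.append_of_mem hp
  have hcode : mmCode k i = (before.flatMap fun (t, r, c) => mmEntryCode k i t r c) ++
      (mmEntryCode k i t r c ++ after.flatMap fun (t, r, c) => mmEntryCode k i t r c) := by
    rw [mmCode_eq_flatMap, hsplit, List.flatMap_append, List.flatMap_cons]
  have hnotin : (t, r, c) ∉ after :=
    (List.nodup_cons.1 (hsplit ▸ nodup_positions k i).of_append_right).1
  rw [hcode, execCode_append, execCode_append]
  refine (execCode_of_forall_dest_ne _ fun I hI hdest => ?_).trans <|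
    (hm.congr fun y hy => execCode_of_isOperand (k := k) (i := i) m (by simp [hcode]) hy)
      |>.execCode_mmEntryCode hi hp
  obtain ⟨⟨t', r', c'⟩, hp', hI⟩ := List.mem_flatMap.1 hI
  rcases dest_of_mem_mmEntryCode hI with h | h <;> rw [hdest] at h
  · obtain ⟨-, rfl, rfl, rfl⟩ := MMCell.m.inj h
    exact hnotin hp'
  · cases h

theorem OperandsReady.mmUp_exec (hi : i < mmDepth k) (hm : OperandsReady k f g (i + 1) m) :
    OperandsReady k f g i ((mmUp k i).exec m) := by
  rw [OperandsReady, if_neg hi.ne]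
  intro t h k' l r c hq
  rw [mmUp_exec_part m hq]
  exact hm.execCode_mmCode hi (child_mem_positions hq)

theorem OperandsReady.execSteps_mmUp {n : ℕ} (hn : n ≤ mmDepth k)
    (hm : OperandsReady k f g n m) :
    OperandsReady k f g 0 (execSteps m ((List.range n).reverse.map (mmUp k))) := by
  induction n generalizing m with
  | zero => exact hm
  | succ n ih =>
    rw [List.range_succ, List.reverse_append, List.reverse_singleton, List.singleton_append,
      List.map_cons]
    exact ih (by omega) (hm.mmUp_exec (by omega))

theorem OperandsReady.mmFinal_exec (hm : OperandsReady k f g 0 m) {r c : ℕ} (hr : r < 2 ^ k)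
    (hc : c < 2 ^ k) : (mmFinal k).exec m (.m 0 0 r c) = subproduct k f g 0 0 r c := by
  rw [Superstep.exec_of_forall_ne]
  · exact hm.execCode_mmCode (Nat.zero_le _) (mem_positions.2 ⟨by simp, hr, hc⟩)
  · intro e he
    obtain ⟨j, -, rfl⟩ := mem_mmDummy.1 he
    simp

/-- The matrix `A` as a function on natural numbers, with the value `0` out of range. -/
def natEntry {N : ℕ} (A : Matrix (Fin N) (Fin N) R) (r c : ℕ) : R :=
  if h : r < N ∧ c < N then A ⟨r, h.1⟩ ⟨c, h.2⟩ else 0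

theorem natEntry_val {N : ℕ} (A : Matrix (Fin N) (Fin N) R) (i j : Fin N) :
    natEntry A i j = A i j := by
  simp [natEntry]

theorem factorsReady_initMem (A B : Matrix (Fin (2 ^ k)) (Fin (2 ^ k)) R) :
    FactorsReady k (natEntry A) (natEntry B) 0 ((mmProgram k).initMem (entryVal A B)) := by
  intro t r c hp
  obtain ⟨ht, hr, hc⟩ := mem_positions.1 hp
  obtain rfl : t = 0 := by simpa using ht
  rw [Nat.sub_zero] at hr hc
  simp [Program.initMem, mmProgram, mmInit, leftFactor, rightFactor, natEntry, entryVal, hr, hc]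

theorem FactorsReady.execSteps_mmProgram (hm : FactorsReady k f g 0 m) {r c : ℕ} (hr : r < 2 ^ k)
    (hc : c < 2 ^ k) : execSteps m (mmProgram k).steps (.m 0 0 r c) = subproduct k f g 0 0 r c := by
  have hdown : OperandsReady k f g (mmDepth k) _ :=
    (if_pos rfl).mpr (hm.execSteps_mmDown (mmDepth_le k))
  refine (congrFun (?_ : _ = (mmFinal k).exec _) _).trans
    ((hdown.execSteps_mmUp le_rfl).mmFinal_exec hr hc)
  exact (execSteps_append ..).trans (execSteps_append ..)

theorem mmProgram_correct (k : ℕ) : (mmProgram k).Correct := by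
  intro R _ A B i j
  calc execSteps _ (mmProgram k).steps ((mmProgram k).out i j)
      = subproduct k (natEntry A) (natEntry B) 0 0 i j :=
        (factorsReady_initMem A B).execSteps_mmProgram i.2 j.2
    _ = ∑ s : Fin (2 ^ k), A i s * B s j := by
        simp only [subproduct, Nat.sub_zero, leftFactor, rightFactor,
          ← Fin.sum_univ_eq_sum_range (fun s => natEntry A i s * natEntry B s j), natEntry_val]
    _ = (A * B) i j := (Matrix.mul_apply ..).symm

theorem mmProgram_noReplication (k : ℕ) : (mmProgram k).NoReplication := by
  have hcell : ∀ (c : MMCell) (x : Entry (2 ^ k)), mmInit k c = some x →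
      c = match x with
        | .a i j => .a 0 0 i j
        | .b i j => .b 0 0 i j := by
    intro c x hx
    unfold mmInit at hx
    split at hx
    · split_ifs at hx
      cases hx
      rfl
    · split_ifs at hx
      cases hx
      rfl
    · cases hx
  exact fun c c' x h h' => (hcell c x h).trans (hcell c' x h').symm

end Correctness

section Owners

theorem four_pow_eq_two_pow (k : ℕ) : 4 ^ k = 2 ^ (2 * k) := by
  rw [pow_mul]; norm_num

theorem eight_pow_mul_four_pow {k i : ℕ} (hi : i ≤ k) :
    8 ^ i * 4 ^ (k - i) = 2 ^ i * 4 ^ k := by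
  conv_rhs => rw [← Nat.add_sub_cancel' hi, pow_add, ← mul_assoc, ← mul_pow]
  norm_num

/-- The number of the position `(r, c)` of the subproblem `t` in the order in which `mmOwner`
spreads the positions of all subproblems of the level `i` over the virtual processors. -/
def positionIndex (k i t r c : ℕ) : ℕ :=
  t * 4 ^ (k - i) + r * 2 ^ (k - i) + c

variable {k i t r c : ℕ}

theorem positionIndex_eq (k i t r c : ℕ) :
    positionIndex k i t r c = (t * 2 ^ (k - i) + r) * 2 ^ (k - i) + c := by
  rw [positionIndex, four_pow_eq_two_pow, two_mul, pow_add]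
  ring

theorem positionIndex_div (hp : (t, r, c) ∈ positions k i) :
    positionIndex k i t r c / 4 ^ (k - i) = t := by
  obtain ⟨-, hr, hc⟩ := mem_positions.1 hp
  rw [positionIndex_eq, four_pow_eq_two_pow, two_mul, pow_add, ← Nat.div_div_eq_div_mul,
    mul_comm _ (2 ^ (k - i)), Nat.mul_add_div (Nat.two_pow_pos _), Nat.div_eq_of_lt hc, add_zero,
    mul_comm, Nat.mul_add_div (Nat.two_pow_pos _), Nat.div_eq_of_lt hr, add_zero]

theorem positionIndex_lt (hi : i ≤ k) (hp : (t, r, c) ∈ positions k i) :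
    positionIndex k i t r c < 2 ^ i * 4 ^ k := by
  rw [← eight_pow_mul_four_pow hi, ← Nat.div_lt_iff_lt_mul (by positivity), positionIndex_div hp]
  exact (mem_positions.1 hp).1

theorem positionIndex_inj {t' r' c' : ℕ} (hp : (t, r, c) ∈ positions k i)
    (hp' : (t', r', c') ∈ positions k i)
    (h : positionIndex k i t r c = positionIndex k i t' r' c') : (t, r, c) = (t', r', c') := by
  obtain ⟨-, hr, hc⟩ := mem_positions.1 hp
  obtain ⟨-, hr', hc'⟩ := mem_positions.1 hp'
  rw [positionIndex_eq, positionIndex_eq] at h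
  obtain ⟨hrow, rfl⟩ := eq_and_eq_of_mul_add_eq hc hc' h
  obtain ⟨rfl, rfl⟩ := eq_and_eq_of_mul_add_eq hr hr' hrow
  rfl

theorem mmOwner_eq (hi : i ≤ k) (hp : (t, r, c) ∈ positions k i) :
    mmOwner k i t r c = positionIndex k i t r c / 2 ^ i :=
  Nat.mod_eq_of_lt (Nat.div_lt_of_lt_mul (positionIndex_lt hi hp))

theorem mmOwner_div {w d : ℕ} (hi : i ≤ k) (hp : (t, r, c) ∈ positions k i)
    (hw : i + w = 2 * (k - i) + d) : mmOwner k i t r c / 2 ^ w = t / 2 ^ d := by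
  rw [mmOwner_eq hi hp, Nat.div_div_eq_div_mul, ← pow_add, hw, pow_add,
    ← Nat.div_div_eq_div_mul, ← four_pow_eq_two_pow, positionIndex_div hp]

theorem mmOwner_child_div {h k' l u v : ℕ} (hi : i < mmDepth k) (hu : u < 2) (hv : v < 2)
    (hq : (t, h, k', l, r, c) ∈ quadrantPositions k i) :
    mmOwner k (i + 1) (8 * t + (4 * h + 2 * k' + l)) r c / 2 ^ (2 * k - 3 * i) =
      mmOwner k i t (u * 2 ^ (k - (i + 1)) + r) (v * 2 ^ (k - (i + 1)) + c) /
        2 ^ (2 * k - 3 * i) := by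
  have hik := lt_of_lt_mmDepth hi
  have hi3 := three_mul_lt_of_lt_mmDepth hi
  obtain ⟨-, hh, hk', hl, -, -⟩ := mem_quadrantPositions.1 hq
  rw [mmOwner_div (d := 3) hik (child_mem_positions hq) (by omega),
    mmOwner_div (d := 0) hik.le (quadrant_mem_positions hik hu hv hq) (by omega)]
  omega

theorem mmHome_lt (k : ℕ) (c : MMCell) : mmHome k c < 2 ^ (2 * k) := by
  rw [← four_pow_eq_two_pow]
  cases c <;> exact Nat.mod_lt _ (by positivity)

theorem two_mul_dummy_shift (hi : 3 * i < 2 * k) :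
    2 * (4 ^ k / 2 ^ (3 * i + 1)) = 2 ^ (2 * k - 3 * i) := by
  rw [four_pow_eq_two_pow, Nat.pow_div (by omega) two_pos, ← pow_succ']
  congr 1
  omega

theorem mmHome_div_eq_of_mem_mmDummy {e : MMCell × MMCell} (hi : 3 * i < 2 * k)
    (he : e ∈ mmDummy k i) :
    mmHome k e.1 / 2 ^ (2 * k - 3 * i) = mmHome k e.2 / 2 ^ (2 * k - 3 * i) := by
  have hshift := two_mul_dummy_shift hi
  obtain ⟨j, hj, rfl⟩ := mem_mmDummy.1 he
  rw [Nat.div_eq_of_lt, Nat.div_eq_of_lt]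
  · exact (Nat.mod_le _ _).trans_lt (by omega)
  · exact (Nat.mod_le _ _).trans_lt (by omega)

end Owners

section Validity

variable {k i : ℕ}

theorem mem_mmProgram_steps {s : Superstep MMCell} : s ∈ (mmProgram k).steps ↔
    (∃ i < mmDepth k, mmDown k i = s) ∨ (∃ i < mmDepth k, mmUp k i = s) ∨ s = mmFinal k := by
  change s ∈ (List.range (mmDepth k)).map (mmDown k) ++
    ((List.range (mmDepth k)).reverse.map (mmUp k) ++ [mmFinal k]) ↔ _
  simp only [List.mem_append, List.mem_map, List.mem_range, List.mem_reverse, List.mem_singleton]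

theorem mmOwner_mmDepth {t r c : ℕ} (hp : (t, r, c) ∈ positions k (mmDepth k)) :
    mmOwner k (mmDepth k) t r c = t / 2 ^ (mmDepth k - 2 * (k - mmDepth k)) := by
  have hD := two_mul_le_three_mul_mmDepth k
  simpa using mmOwner_div (w := 0) (mmDepth_le k) hp (by have := mmDepth_le k; omega)

theorem isLocal_of_mem_mmCode {I : Instr MMCell} (hI : I ∈ mmCode k i) :
    I.IsLocal (mmHome k) := by
  obtain ⟨t, r, c, hp, hI⟩ := mem_mmCode.1 hI
  unfold mmEntryCode at hI
  split_ifs at hI with hlast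
  · subst hlast
    obtain ⟨ht, hr, hc⟩ := mem_positions.1 hp
    rcases List.mem_cons.1 hI with rfl | hI
    · trivial
    · obtain ⟨s, hs, rfl | rfl⟩ := mem_innerProductCode.1 hI
      · have hleft := mmOwner_mmDepth (mem_positions.2 ⟨ht, hr, hs⟩)
        have hright := mmOwner_mmDepth (mem_positions.2 ⟨ht, hs, hc⟩)
        have hprod := mmOwner_mmDepth hp
        exact ⟨hleft.trans hprod.symm, hright.trans hprod.symm⟩
      · exact ⟨rfl, rfl⟩
  · rw [List.mem_singleton.1 hI]
    exact ⟨rfl, rfl⟩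

theorem mmHome_div_eq_of_mem_mmDown {e : MMCell × MMCell} (hi : i < mmDepth k)
    (he : e ∈ (mmDown k i).msgs) :
    mmHome k e.1 / 2 ^ (2 * k - 3 * i) = mmHome k e.2 / 2 ^ (2 * k - 3 * i) := by
  rcases mem_mmDown_msgs.1 he with ⟨t, h, k', l, r, c, hq, he⟩ | he
  · obtain ⟨-, hh, hk', hl, -, -⟩ := mem_quadrantPositions.1 hq
    rcases he with rfl | rfl
    · exact (mmOwner_child_div hi hh hl hq).symm
    · exact (mmOwner_child_div hi hl hk' hq).symm
  · exact mmHome_div_eq_of_mem_mmDummy (three_mul_lt_of_lt_mmDepth hi) he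

theorem mmHome_div_eq_of_mem_mmUp {e : MMCell × MMCell} (hi : i < mmDepth k)
    (he : e ∈ (mmUp k i).msgs) :
    mmHome k e.1 / 2 ^ (2 * k - 3 * i) = mmHome k e.2 / 2 ^ (2 * k - 3 * i) := by
  rcases mem_mmUp_msgs.1 he with ⟨t, h, k', l, r, c, hq, rfl⟩ | he
  · obtain ⟨-, hh, hk', -, -, -⟩ := mem_quadrantPositions.1 hq
    exact mmOwner_child_div hi hh hk' hq
  · exact mmHome_div_eq_of_mem_mmDummy (three_mul_lt_of_lt_mmDepth hi) he

theorem mmProgram_valid (hk : 0 < k) : (mmProgram k).Valid (2 * k) where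
  home_lt := mmHome_lt k
  code_local s hs I hI := by
    have hloc : I.IsLocal (mmHome k) := by
      rcases mem_mmProgram_steps.1 hs with ⟨i, -, rfl⟩ | ⟨i, -, rfl⟩ | rfl
      · exact (List.not_mem_nil hI).elim
      · exact isLocal_of_mem_mmCode hI
      · exact isLocal_of_mem_mmCode hI
    cases I <;> exact hloc
  msgs_cluster s hs e he := by
    rcases mem_mmProgram_steps.1 hs with ⟨i, hi, rfl⟩ | ⟨i, hi, rfl⟩ | rfl
    · exact mmHome_div_eq_of_mem_mmDown hi he
    · exact mmHome_div_eq_of_mem_mmUp hi he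
    · exact mmHome_div_eq_of_mem_mmDummy (i := 0) (by omega) he

theorem Program.Valid.fold {N b e : ℕ} {P : Program N} (hP : P.Valid (b + e)) :
    (P.fold e).Valid b where
  home_lt c := Nat.div_lt_of_lt_mul (by
    rw [← pow_add, add_comm]
    exact hP.home_lt c)
  code_local s hs I hI := by
    have hloc := hP.isLocal hs hI
    cases I with
    | zero d => trivial
    | one d => trivial
    | add d x y => exact hloc.imp (congrArg (· / 2 ^ e)) (congrArg (· / 2 ^ e))
    | mul d x y => exact hloc.imp (congrArg (· / 2 ^ e)) (congrArg (· / 2 ^ e))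
  msgs_cluster s hs x hx := by
    obtain ⟨d, hd⟩ := Nat.exists_eq_add_of_le
      (show b + e - s.label ≤ e + (b - s.label) by omega)
    have hdiv : ∀ y : ℕ, y / 2 ^ e / 2 ^ (b - s.label) = y / 2 ^ (b + e - s.label) / 2 ^ d :=
      fun y => by rw [Nat.div_div_eq_div_mul, Nat.div_div_eq_div_mul, ← pow_add, ← pow_add, hd]
    exact ((hdiv _).trans (congrArg (· / 2 ^ d) (hP.msgs_cluster s hs x hx))).trans (hdiv _).symm

end Validity

section Membership

variable {k : ℕ}

theorem mul_mem_mmCode {i : ℕ} {d x y : MMCell} (hmul : .mul d x y ∈ mmCode k i) :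
    i = mmDepth k ∧ ∃ t r c, (t, r, c) ∈ positions k i ∧ ∃ s < 2 ^ (k - i),
      d = .tmp i t r c ∧ x = .a i t r s ∧ y = .b i t s c := by
  obtain ⟨t, r, c, hp, hI⟩ := mem_mmCode.1 hmul
  unfold mmEntryCode at hI
  split_ifs at hI with hlast
  · simp only [List.mem_cons, mem_innerProductCode, reduceCtorEq, Instr.mul.injEq, or_false,
      false_or] at hI
    exact ⟨hlast, t, r, c, hp, hI⟩
  · simp at hI

theorem before_eq_of_mul_mem_code (hk : 0 < k) {before after : List (Superstep MMCell)}
    {s : Superstep MMCell} (hsteps : (mmProgram k).steps = before ++ s :: after)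
    {d x y : MMCell} (hmul : .mul d x y ∈ s.code) :
    before = (List.range (mmDepth k)).map (mmDown k) ∧ s.code = mmCode k (mmDepth k) := by
  obtain ⟨n, hn⟩ : ∃ n, mmDepth k = n + 1 :=
    Nat.exists_eq_add_one.2 (by have := two_mul_le_three_mul_mmDepth k; omega)
  have hsteps' : (List.range (mmDepth k)).map (mmDown k) ++
      mmUp k n :: ((List.range n).reverse.map (mmUp k) ++ [mmFinal k]) = before ++ s :: after := by
    rw [← hsteps]
    change _ = (List.range (mmDepth k)).map (mmDown k) ++
      ((List.range (mmDepth k)).reverse.map (mmUp k) ++ [mmFinal k])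
    rw [hn, List.range_succ (n := n), List.reverse_append, List.reverse_singleton,
      List.singleton_append, List.map_cons, List.cons_append]
  have hdown : s ∉ (List.range (mmDepth k)).map (mmDown k) := fun hs => by
    obtain ⟨i, -, rfl⟩ := List.mem_map.1 hs
    exact List.not_mem_nil hmul
  have hup : s ∉ (List.range n).reverse.map (mmUp k) ++ [mmFinal k] := fun hs => by
    simp only [List.mem_append, List.mem_map, List.mem_reverse, List.mem_range,
      List.mem_singleton] at hs
    rcases hs with ⟨i, hi, rfl⟩ | rfl
    · have := (mul_mem_mmCode hmul).1
      omega
    · have := (mul_mem_mmCode hmul).1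
      omega
  obtain ⟨hbefore, rfl, -⟩ := (List.append_cons_inj_of_notMem hdown hup).1 hsteps'
  exact ⟨hbefore.symm, by rw [hn]; rfl⟩

/-- The left input matrix of the symbolic execution. -/
noncomputable def symLeft (N : ℕ) : ℕ → ℕ → FreeAlgebra ℕ (Entry N) :=
  natEntry (.of fun i j => FreeAlgebra.ι ℕ (.a i j))

/-- The right input matrix of the symbolic execution. -/
noncomputable def symRight (N : ℕ) : ℕ → ℕ → FreeAlgebra ℕ (Entry N) :=
  natEntry (.of fun i j => FreeAlgebra.ι ℕ (.b i j))

theorem factorsReady_symInit (k : ℕ) :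
    FactorsReady k (symLeft (2 ^ k)) (symRight (2 ^ k)) 0 (mmProgram k).symInit := by
  have hval : entryVal (.of fun i j => FreeAlgebra.ι ℕ (.a i j))
      (.of fun i j => FreeAlgebra.ι ℕ (.b i j)) = FreeAlgebra.ι ℕ (X := Entry (2 ^ k)) :=
    funext fun x => by cases x <;> rfl
  rw [Program.symInit, ← hval]
  exact factorsReady_initMem _ _

theorem exists_position_of_mem_termsComputed (hk : 0 < k) {e q : ℕ}
    {τ : Fin (2 ^ k) × Fin (2 ^ k) × Fin (2 ^ k)}
    (hτ : τ ∈ ((mmProgram k).fold e).termsComputed q) :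
    ∃ t r c, (t, r, c) ∈ positions k (mmDepth k) ∧ ∃ s < 2 ^ (k - mmDepth k),
      mmOwner k (mmDepth k) t r c / 2 ^ e = q ∧
      leftFactor k (symLeft (2 ^ k)) (mmDepth k) t r s = FreeAlgebra.ι ℕ (.a τ.1 τ.2.1) ∧
      rightFactor k (symRight (2 ^ k)) (mmDepth k) t s c = FreeAlgebra.ι ℕ (.b τ.2.1 τ.2.2) := by
  obtain ⟨before, after, step, pre, post, d, x, y, hsteps, hcode, hd, hx, hy⟩ :
      ∃ (before after : List (Superstep MMCell)) (step : Superstep MMCell)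
        (pre post : List (Instr MMCell)) (d x y : MMCell),
        (mmProgram k).steps = before ++ step :: after ∧ step.code = pre ++ .mul d x y :: post ∧
        mmHome k d / 2 ^ e = q ∧
        execCode (execSteps (γ := MMCell) (mmProgram k).symInit before) pre x =
          FreeAlgebra.ι ℕ (.a τ.1 τ.2.1) ∧
        execCode (execSteps (γ := MMCell) (mmProgram k).symInit before) pre y =
          FreeAlgebra.ι ℕ (.b τ.2.1 τ.2.2) := hτ
  obtain ⟨rfl, hcode'⟩ := before_eq_of_mul_mem_code hk hsteps (d := d) (x := x) (y := y)
    (by rw [hcode]; simp)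
  rw [hcode'] at hcode
  have hpre : pre ⊆ mmCode k (mmDepth k) := by rw [hcode]; simp
  obtain ⟨-, t, r, c, hp, s, hs, rfl, rfl, rfl⟩ :=
    mul_mem_mmCode (show .mul d x y ∈ mmCode k (mmDepth k) by rw [hcode]; simp)
  obtain ⟨ht, hr, hc⟩ := mem_positions.1 hp
  have hready := (factorsReady_symInit k).execSteps_mmDown (mmDepth_le k)
  refine ⟨t, r, c, hp, s, hs, hd, ?_, ?_⟩
  · rw [← (hready t r s (mem_positions.2 ⟨ht, hr, hs⟩)).1, ← hx]
    exact (execCode_of_isOperand (y := .a ..) _ hpre trivial).symm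
  · rw [← (hready t s c (mem_positions.2 ⟨ht, hs, hc⟩)).2, ← hy]
    exact (execCode_of_isOperand (y := .b ..) _ hpre trivial).symm

theorem ncard_termsComputed_mmProgram_fold_le (hk : 0 < k) {a : ℕ} (ha : a ≤ 2 * k) (q : ℕ) :
    (((mmProgram k).fold (2 * k - a)).termsComputed q).ncard ≤ 2 ^ (3 * k - a) := by
  classical
  have hD := two_mul_le_three_mul_mmDepth k
  have hDk := mmDepth_le k
  set E := 3 * mmDepth k - 2 * k + (2 * k - a)
  let range := Finset.range (2 ^ (k - mmDepth k))
  let T : Finset (ℕ × ℕ × ℕ × ℕ) :=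
    Finset.Ico (q * 2 ^ E) ((q + 1) * 2 ^ E) ×ˢ range ×ˢ range ×ˢ range
  have hcard : T.card = 2 ^ (3 * k - a) := by
    simp only [T, range, Finset.card_product, Nat.card_Ico, Finset.card_range, ← Nat.sub_mul,
      Nat.add_sub_cancel_left, one_mul, ← pow_add]
    congr 1
    omega
  rw [← hcard, Set.ncard_eq_toFinset_card _ (Set.toFinite _)]
  refine Finset.card_le_card_of_forall_subsingleton (fun τ σ =>
      leftFactor k (symLeft (2 ^ k)) (mmDepth k) σ.1 σ.2.1 σ.2.2.1 =
        FreeAlgebra.ι ℕ (.a τ.1 τ.2.1) ∧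
      rightFactor k (symRight (2 ^ k)) (mmDepth k) σ.1 σ.2.2.1 σ.2.2.2 =
        FreeAlgebra.ι ℕ (.b τ.2.1 τ.2.2))
    (fun τ hτ => ?_) ?_
  · obtain ⟨t, r, c, hp, s, hs, hq, hleft, hright⟩ :=
      exists_position_of_mem_termsComputed hk ((Set.Finite.mem_toFinset _).1 hτ)
    obtain ⟨-, hr, hc⟩ := mem_positions.1 hp
    rw [mmOwner_div (d := E) hDk hp (by omega), Nat.div_eq_iff (Nat.two_pow_pos E)] at hq
    refine ⟨(t, r, s, c), ?_, hleft, hright⟩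
    simp only [T, range, Finset.mem_product, Finset.mem_Ico, Finset.mem_range, add_one_mul]
    have := Nat.two_pow_pos E
    exact ⟨⟨by omega, by omega⟩, hr, hs, hc⟩
  · rintro σ - ⟨i, s, j⟩ ⟨-, hleft, hright⟩ ⟨i', s', j'⟩ ⟨-, hleft', hright'⟩
    have hA := FreeAlgebra.ι_injective (hleft.symm.trans hleft')
    have hB := FreeAlgebra.ι_injective (hright.symm.trans hright')
    simp only [Entry.a.injEq, Entry.b.injEq] at hA hB
    rw [hA.1, hA.2, hB.2]

theorem load_mmProgram_fold_le (hk : 0 < k) {a : ℕ} (ha : a ≤ 2 * k) (q : ℕ) :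
    ((((mmProgram k).fold (2 * k - a)).termsComputed q).ncard : ℝ) ≤
      ((2 ^ k : ℕ) : ℝ) ^ 3 / min (2 ^ a) (11 ^ 3) :=
  calc ((((mmProgram k).fold (2 * k - a)).termsComputed q).ncard : ℝ)
    _ ≤ 2 ^ (3 * k - a) := by exact_mod_cast ncard_termsComputed_mmProgram_fold_le hk ha q
    _ = ((2 ^ k : ℕ) : ℝ) ^ 3 / 2 ^ a := by
      rw [eq_div_iff (by positivity), ← pow_add, Nat.cast_pow, Nat.cast_ofNat, ← pow_mul]
      congr 1
      omega
    _ ≤ ((2 ^ k : ℕ) : ℝ) ^ 3 / min (2 ^ a) (11 ^ 3) := by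
      gcongr
      exact min_le_left _ _

theorem mmClass_mmProgram_fold {a : ℕ} (ha : 0 < a) (hak : a ≤ 2 * k) :
    MMClass a ((mmProgram k).fold (2 * k - a)) := by
  induction a using Nat.strong_induction_on with
  | _ a ih =>
    have hk : 0 < k := by omega
    have hvalid : (mmProgram k).Valid (a + (2 * k - a)) := by
      rw [Nat.add_sub_cancel' hak]
      exact mmProgram_valid hk
    refine .intro a _ hvalid.fold (mmProgram_correct k) (mmProgram_noReplication k)
      (fun q _ => load_mmProgram_fold_le hk hak q) fun b hb hba => ?_
    rw [Program.fold_fold, show 2 * k - a + (a - b) = 2 * k - b by omega]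
    exact ih b hba hb (by omega)

end Membership

section Counts

theorem countP_div_eq_le {α : Type*} {l : List α} (hl : l.Nodup) {φ : α → ℕ}
    (hφ : ∀ x ∈ l, ∀ y ∈ l, φ x = φ y → x = y) {M : ℕ} (hM : 0 < M) (q : ℕ) :
    l.countP (fun x => φ x / M = q) ≤ M := by
  classical
  rw [List.countP_eq_length_filter, ← List.toFinset_card_of_nodup (hl.filter _)]
  calc _ ≤ (Finset.Ico (q * M) (q * M + M)).card := by
        refine Finset.card_le_card_of_injOn φ (fun x hx => ?_) fun x hx y hy => ?_
        · have hq := of_decide_eq_true (List.mem_filter.1 (List.mem_toFinset.1 hx)).2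
          rw [Nat.div_eq_iff hM] at hq
          exact Finset.mem_coe.2 (Finset.mem_Ico.2 (by omega))
        · exact hφ x (List.mem_filter.1 (List.mem_toFinset.1 hx)).1 y
            (List.mem_filter.1 (List.mem_toFinset.1 hy)).1
    _ = M := by rw [Nat.card_Ico, Nat.add_sub_cancel_left]

theorem countP_range_add_mod_div_eq_le {m d n M : ℕ} (h : m + d ≤ n) (hM : 0 < M) (q : ℕ) :
    (List.range m).countP (fun j => (j + d) % n / M = q) ≤ M := by
  refine countP_div_eq_le List.nodup_range (fun x hx y hy hxy => ?_) hM q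
  rw [List.mem_range] at hx hy
  rwa [Nat.mod_eq_of_lt (by omega), Nat.mod_eq_of_lt (by omega), Nat.add_right_cancel_iff] at hxy

theorem countP_flatMap_replicate {α β : Type*} (l : List α) (n : ℕ) (x : α → β) (p : β → Bool) :
    (l.flatMap fun j => List.replicate n (x j)).countP p = n * l.countP fun j => p (x j) := by
  induction l with
  | nil => rfl
  | cons a l ih =>
    rw [List.flatMap_cons, List.countP_append, ih, List.countP_cons, List.countP_replicate]
    split_ifs <;> ring

theorem countP_flatMap_pair {α β : Type*} (l : List α) (x y : α → β) (p : β → Bool) :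
    (l.flatMap fun j => [x j, y j]).countP p =
      (l.countP fun j => p (x j)) + l.countP fun j => p (y j) := by
  induction l with
  | nil => rfl
  | cons a l ih =>
    simp only [List.flatMap_cons, List.cons_append, List.nil_append, List.countP_cons, ih]
    omega

variable {k i : ℕ}

theorem countP_mmOwner_child_le (hi : i < k) (e q : ℕ) :
    (quadrantPositions k i).countP (fun (t, h, k', l, r, c) =>
      mmOwner k (i + 1) (8 * t + (4 * h + 2 * k' + l)) r c / 2 ^ e = q) ≤ 2 * 2 ^ (i + e) := by
  have hcount := countP_div_eq_le (nodup_quadrantPositions k i)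
    (φ := fun (t, h, k', l, r, c) => positionIndex k (i + 1) (8 * t + (4 * h + 2 * k' + l)) r c)
    (fun ⟨_, _, _, _, _, _⟩ hq₁ ⟨_, _, _, _, _, _⟩ hq₂ heq => by
      have := positionIndex_inj (child_mem_positions hq₁) (child_mem_positions hq₂) heq
      simp only [Prod.mk.injEq] at this ⊢
      obtain ⟨hchild, hr, hc⟩ := this
      obtain ⟨ht, hh, hk', hl⟩ := child_inj hq₁ hq₂ hchild
      exact ⟨ht, hh, hk', hl, hr, hc⟩)
    (M := 2 * 2 ^ (i + e)) (by positivity) q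
  refine (List.countP_mono_left fun ⟨t, h, k', l, r, c⟩ hq howner => ?_).trans hcount
  simp only [decide_eq_true_eq] at howner ⊢
  rwa [mmOwner_eq hi (child_mem_positions hq), Nat.div_div_eq_div_mul, ← pow_add,
    show 2 ^ (i + 1 + e) = 2 * 2 ^ (i + e) by ring] at howner

/- Two tuples that share a position differ in the third bit of the value of `σ`, so appending this
bit to the number of the position numbers the tuples injectively. -/
theorem countP_mmOwner_quadrant_le {σ : ℕ × ℕ × ℕ → ℕ × ℕ × ℕ} (hi : i < k)
    (hσ : σ.Injective) (hσ₂ : ∀ h < 2, ∀ k' < 2, ∀ l < 2,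
      (σ (h, k', l)).1 < 2 ∧ (σ (h, k', l)).2.1 < 2 ∧ (σ (h, k', l)).2.2 < 2) (e q : ℕ) :
    (quadrantPositions k i).countP (fun (t, h, k', l, r, c) =>
      mmOwner k i t ((σ (h, k', l)).1 * 2 ^ (k - (i + 1)) + r)
        ((σ (h, k', l)).2.1 * 2 ^ (k - (i + 1)) + c) / 2 ^ e = q) ≤ 2 * 2 ^ (i + e) := by
  have hmem : ∀ {t h k' l r c}, (t, h, k', l, r, c) ∈ quadrantPositions k i →
      (σ (h, k', l)).2.2 < 2 ∧ (t, (σ (h, k', l)).1 * 2 ^ (k - (i + 1)) + r,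
        (σ (h, k', l)).2.1 * 2 ^ (k - (i + 1)) + c) ∈ positions k i := fun hq => by
    obtain ⟨-, hh, hk', hl, -, -⟩ := mem_quadrantPositions.1 hq
    obtain ⟨hu, hv, hw⟩ := hσ₂ _ hh _ hk' _ hl
    exact ⟨hw, quadrant_mem_positions hi hu hv hq⟩
  have hcount := countP_div_eq_le (nodup_quadrantPositions k i)
    (φ := fun (t, h, k', l, r, c) => positionIndex k i t
        ((σ (h, k', l)).1 * 2 ^ (k - (i + 1)) + r)
        ((σ (h, k', l)).2.1 * 2 ^ (k - (i + 1)) + c) * 2 + (σ (h, k', l)).2.2)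
    (fun ⟨_, _, _, _, _, _⟩ hq₁ ⟨_, _, _, _, _, _⟩ hq₂ heq => by
      obtain ⟨-, -, -, -, hr₁, hc₁⟩ := mem_quadrantPositions.1 hq₁
      obtain ⟨-, -, -, -, hr₂, hc₂⟩ := mem_quadrantPositions.1 hq₂
      obtain ⟨hpos, hthird⟩ := eq_and_eq_of_mul_add_eq (hmem hq₁).1 (hmem hq₂).1 heq
      have hpos := positionIndex_inj (hmem hq₁).2 (hmem hq₂).2 hpos
      simp only [Prod.mk.injEq] at hpos
      obtain ⟨rfl, hrow, hcol⟩ := hpos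
      obtain ⟨hfirst, rfl⟩ := eq_and_eq_of_mul_add_eq hr₁ hr₂ hrow
      obtain ⟨hsecond, rfl⟩ := eq_and_eq_of_mul_add_eq hc₁ hc₂ hcol
      have hbits := hσ (Prod.ext hfirst (Prod.ext hsecond hthird))
      simp only [Prod.mk.injEq] at hbits
      obtain ⟨rfl, rfl, rfl⟩ := hbits
      rfl)
    (M := 2 * 2 ^ (i + e)) (by positivity) q
  refine (List.countP_mono_left fun ⟨t, h, k', l, r, c⟩ hq howner => ?_).trans hcount
  simp only [decide_eq_true_eq] at howner ⊢
  rw [mmOwner_eq hi.le (hmem hq).2, Nat.div_div_eq_div_mul, ← pow_add] at howner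
  have hthird := (hmem hq).1
  rw [← Nat.div_div_eq_div_mul, ← howner]
  congr 1
  omega

theorem countP_mmHome_fst_mmDummy_le (k i e q : ℕ) :
    (mmDummy k i).countP (fun x => mmHome k x.1 / 2 ^ e = q) ≤ 2 ^ (i + e) := by
  rw [mmDummy, countP_flatMap_replicate, pow_add 2 i e]
  refine Nat.mul_le_mul_left _ (countP_range_add_mod_div_eq_le (d := 0) ?_ (Nat.two_pow_pos e) q)
  exact Nat.div_le_self _ _

theorem countP_mmHome_snd_mmDummy_le (hi : 3 * i < 2 * k) (e q : ℕ) :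
    (mmDummy k i).countP (fun x => mmHome k x.2 / 2 ^ e = q) ≤ 2 ^ (i + e) := by
  have hshift := two_mul_dummy_shift hi
  have hle : 2 ^ (2 * k - 3 * i) ≤ 4 ^ k := by
    rw [four_pow_eq_two_pow]
    exact Nat.pow_le_pow_right two_pos (Nat.sub_le _ _)
  rw [mmDummy, countP_flatMap_replicate, pow_add 2 i e]
  refine Nat.mul_le_mul_left _ (countP_range_add_mod_div_eq_le ?_ (Nat.two_pow_pos e) q)
  omega

end Counts

section Degrees

variable {k i : ℕ}

theorem degree_fold_le_of_countP {N e B : ℕ} {P : Program N} {s : Superstep P.Cell}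
    (hsent : ∀ q, (s.msgs.countP fun x => P.home x.1 / 2 ^ e = q) ≤ B)
    (hreceived : ∀ q, (s.msgs.countP fun x => P.home x.2 / 2 ^ e = q) ≤ B) (a : ℕ) :
    (P.fold e).degree a s ≤ B := by
  refine Finset.sup_le fun q _ => max_le ?_ ?_
  · refine (List.countP_mono_left fun x _ hx => ?_).trans (hsent q)
    exact decide_eq_true (of_decide_eq_true hx).1
  · refine (List.countP_mono_left fun x _ hx => ?_).trans (hreceived q)
    exact decide_eq_true (of_decide_eq_true hx).1

theorem countP_mmDown_msgs (p : MMCell × MMCell → Bool) :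
    (mmDown k i).msgs.countP p =
      (quadrantPositions k i).countP (fun (t, h, k', l, r, c) =>
        p (.a i t (h * 2 ^ (k - (i + 1)) + r) (l * 2 ^ (k - (i + 1)) + c),
          .a (i + 1) (8 * t + (4 * h + 2 * k' + l)) r c)) +
      (quadrantPositions k i).countP (fun (t, h, k', l, r, c) =>
        p (.b i t (l * 2 ^ (k - (i + 1)) + r) (k' * 2 ^ (k - (i + 1)) + c),
          .b (i + 1) (8 * t + (4 * h + 2 * k' + l)) r c)) +
      (mmDummy k i).countP p := by
  rw [mmDown, mmForAll_eq_flatMap, List.countP_append, countP_flatMap_pair]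

theorem countP_mmUp_msgs (p : MMCell × MMCell → Bool) :
    (mmUp k i).msgs.countP p =
      (quadrantPositions k i).countP (fun (t, h, k', l, r, c) =>
        p (.m (i + 1) (8 * t + (4 * h + 2 * k' + l)) r c,
          .part i t l (h * 2 ^ (k - (i + 1)) + r) (k' * 2 ^ (k - (i + 1)) + c))) +
      (mmDummy k i).countP p := by
  rw [mmUp, mmForAll_eq_flatMap, List.countP_append, ← List.map_eq_flatMap, List.countP_map]
  rfl

theorem degree_mmDown_le (hi : i < mmDepth k) (a e : ℕ) :
    ((mmProgram k).fold e).degree a (mmDown k i) ≤ 5 * 2 ^ (i + e) := by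
  have hik := lt_of_lt_mmDepth hi
  have hi3 := three_mul_lt_of_lt_mmDepth hi
  refine degree_fold_le_of_countP (P := mmProgram k) (s := mmDown k i) (fun q => ?_)
    (fun q => ?_) a
  · have hA := countP_mmOwner_quadrant_le (σ := fun (h, k', l) => (h, l, k')) hik
      (fun ⟨_, _, _⟩ ⟨_, _, _⟩ h => by simp_all)
      (fun _ hh _ hk' _ hl => ⟨hh, hl, hk'⟩) e q
    have hB := countP_mmOwner_quadrant_le (σ := fun (h, k', l) => (l, k', h)) hik
      (fun ⟨_, _, _⟩ ⟨_, _, _⟩ h => by simp_all)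
      (fun _ hh _ hk' _ hl => ⟨hl, hk', hh⟩) e q
    refine (countP_mmDown_msgs _).trans_le ?_
    exact (add_le_add (add_le_add hA hB) (countP_mmHome_fst_mmDummy_le k i e q)).trans_eq (by ring)
  · have hchild := countP_mmOwner_child_le hik e q
    refine (countP_mmDown_msgs _).trans_le ?_
    exact (add_le_add (add_le_add hchild hchild)
      (countP_mmHome_snd_mmDummy_le hi3 e q)).trans_eq (by ring)

theorem degree_mmUp_le (hi : i < mmDepth k) (a e : ℕ) :
    ((mmProgram k).fold e).degree a (mmUp k i) ≤ 5 * 2 ^ (i + e) := by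
  have hik := lt_of_lt_mmDepth hi
  have hi3 := three_mul_lt_of_lt_mmDepth hi
  refine degree_fold_le_of_countP (P := mmProgram k) (s := mmUp k i) (fun q => ?_)
    (fun q => ?_) a
  · refine (countP_mmUp_msgs _).trans_le ?_
    exact (add_le_add (countP_mmOwner_child_le hik e q)
      (countP_mmHome_fst_mmDummy_le k i e q)).trans (by omega)
  · have hC := countP_mmOwner_quadrant_le (σ := id) hik Function.injective_id
      (fun _ hh _ hk' _ hl => ⟨hh, hk', hl⟩) e q
    refine (countP_mmUp_msgs _).trans_le ?_
    exact (add_le_add hC (countP_mmHome_snd_mmDummy_le hi3 e q)).trans (by omega)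

theorem degree_mmFinal_le (hk : 0 < k) (a e : ℕ) :
    ((mmProgram k).fold e).degree a (mmFinal k) ≤ 5 * 2 ^ e := by
  have hle : 2 ^ (0 + e) ≤ 5 * 2 ^ e := by rw [zero_add]; omega
  exact degree_fold_le_of_countP (P := mmProgram k) (s := mmFinal k)
    (fun q => (countP_mmHome_fst_mmDummy_le k 0 e q).trans hle)
    (fun q => (countP_mmHome_snd_mmDummy_le (i := 0) (by omega) e q).trans hle) a

end Degrees

section CommunicationTime

theorem sum_filter_label_le {γ : Type} {l : List ℕ} (hl : l.Nodup) {f : ℕ → Superstep γ}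
    (hf : ∀ i ∈ l, (f i).label = 3 * i) {d : Superstep γ → ℕ} {B : ℕ → ℕ}
    (hd : ∀ i ∈ l, d (f i) ≤ B i) (n : ℕ) :
    (((l.map f).filter fun s => s.label = n).map d).sum ≤ if 3 ∣ n then B (n / 3) else 0 := by
  rw [List.filter_map, Function.comp_def]
  split_ifs with hn
  · have hfilter : (l.filter fun i => (f i).label = n) =
        List.replicate (l.count (n / 3)) (n / 3) := by
      rw [← List.filter_eq]
      exact List.filter_congr fun i hi => by rw [hf i hi, decide_eq_decide]; omega
    rw [hfilter, List.map_replicate, List.map_replicate, List.sum_replicate, smul_eq_mul]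
    by_cases hmem : n / 3 ∈ l
    · simpa only [List.count_eq_one_of_mem hl hmem, one_mul] using hd _ hmem
    · simp only [List.count_eq_zero_of_not_mem hmem, zero_mul, zero_le]
  · have hfilter : (l.filter fun i => (f i).label = n) = [] :=
      List.filter_eq_nil_iff.2 fun i hi => by rw [hf i hi, decide_eq_true_eq]; omega
    rw [hfilter]
    rfl

variable {k : ℕ}

theorem sum_stepsWithLabel_le {d : Superstep MMCell → ℕ} {B : ℕ → ℕ}
    (hdown : ∀ i < mmDepth k, d (mmDown k i) ≤ B i) (hup : ∀ i < mmDepth k, d (mmUp k i) ≤ B i)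
    (hfinal : d (mmFinal k) ≤ B 0) (e n : ℕ) :
    ((((mmProgram k).fold e).stepsWithLabel n).map d).sum ≤
      3 * if 3 ∣ n then B (n / 3) else 0 := by
  have hdowns := sum_filter_label_le (List.nodup_range (n := mmDepth k)) (f := mmDown k)
    (fun _ _ => rfl) (fun i hi => hdown i (List.mem_range.1 hi)) n
  have hups := sum_filter_label_le (List.nodup_reverse.2 (List.nodup_range (n := mmDepth k)))
    (f := mmUp k) (fun _ _ => rfl)
    (fun i hi => hup i (List.mem_range.1 (List.mem_reverse.1 hi))) n
  have hlast := sum_filter_label_le (List.nodup_singleton 0) (f := fun _ => mmFinal k)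
    (d := d) (B := B) (by simp [mmFinal]) (by simpa using hfinal) n
  change ((((List.range (mmDepth k)).map (mmDown k) ++
    ((List.range (mmDepth k)).reverse.map (mmUp k) ++ [0].map fun _ => mmFinal k)).filter
      fun s => s.label = n).map d).sum ≤ _
  simp only [List.filter_append, List.map_append, List.sum_append]
  omega

theorem cumDegree_mmProgram_fold_le (hk : 0 < k) (a e n : ℕ) :
    (((mmProgram k).fold e).cumDegree a n : ℝ) ≤ 15 * 2 ^ e * labelWeight n := by
  have hsum : ((mmProgram k).fold e).cumDegree a n ≤
      3 * if 3 ∣ n then 5 * 2 ^ (n / 3 + e) else 0 :=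
    sum_stepsWithLabel_le (B := fun i => 5 * 2 ^ (i + e)) (fun i hi => degree_mmDown_le hi a e)
      (fun i hi => degree_mmUp_le hi a e) (by simpa using degree_mmFinal_le hk a e) e n
  refine (Nat.cast_le.2 hsum).trans_eq ?_
  unfold labelWeight
  split_ifs
  · push_cast
    ring
  · simp

theorem numSteps_mmProgram_fold_le (k e n : ℕ) :
    (((mmProgram k).fold e).numSteps n : ℝ) ≤ 3 * labelWeight n := by
  have hsum : ((mmProgram k).fold e).numSteps n ≤ 3 * if 3 ∣ n then 1 else 0 := by
    have hlength : ∀ l : List (Superstep MMCell), (l.map fun _ => 1).sum = l.length := by simp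
    exact (hlength _).symm.trans_le (sum_stepsWithLabel_le (B := fun _ => 1)
      (fun _ _ => le_rfl) (fun _ _ => le_rfl) le_rfl e n)
  refine (Nat.cast_le.2 hsum).trans ?_
  unfold labelWeight
  split_ifs
  · have : (1 : ℝ) ≤ 2 ^ (n / 3) := one_le_pow₀ one_le_two
    push_cast
    linarith
  · simp

theorem commTime_mmProgram_fold_le {K : ℝ} (hK : 0 ≤ K) {a : ℕ} (ha : 0 < a) (hak : a ≤ 2 * k)
    {g ℓ : Fin a → ℝ} (hg : ∀ i, 0 < g i) (hanti : Antitone fun i => ℓ i / g i)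
    (hℓ : ℓ ⟨0, ha⟩ / g ⟨0, ha⟩ ≤ K * ((4 : ℝ) ^ k / 2 ^ a)) :
    ((mmProgram k).fold (2 * k - a)).commTime a g ℓ ≤
      (15 + 3 * K) * ((4 : ℝ) ^ k / 2 ^ a) * ∑ i : Fin a, labelWeight i * g i := by
  have hfold : (2 : ℝ) ^ (2 * k - a) = 4 ^ k / 2 ^ a := by
    rw [eq_div_iff (by positivity), ← pow_add, Nat.sub_add_cancel hak, pow_mul]
    norm_num
  rw [Finset.mul_sum]
  refine Finset.sum_le_sum fun i _ => ?_
  have hlatency : ℓ i ≤ K * ((4 : ℝ) ^ k / 2 ^ a) * g i := by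
    rw [← div_le_iff₀ (hg i)]
    exact (hanti (Fin.mk_le_mk.2 (Nat.zero_le i) : (⟨0, ha⟩ : Fin a) ≤ i)).trans hℓ
  have hgi := (hg i).le
  calc (((mmProgram k).fold (2 * k - a)).cumDegree a i : ℝ) * g i +
        ((mmProgram k).fold (2 * k - a)).numSteps i * ℓ i
    _ ≤ (((mmProgram k).fold (2 * k - a)).cumDegree a i : ℝ) * g i +
        ((mmProgram k).fold (2 * k - a)).numSteps i * (K * ((4 : ℝ) ^ k / 2 ^ a) * g i) := by
      gcongr
    _ ≤ 15 * 2 ^ (2 * k - a) * labelWeight i * g i +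
        3 * labelWeight i * (K * ((4 : ℝ) ^ k / 2 ^ a) * g i) := by
      gcongr
      · exact cumDegree_mmProgram_fold_le (by omega) a _ _
      · exact numSteps_mmProgram_fold_le k _ _
    _ = (15 + 3 * K) * ((4 : ℝ) ^ k / 2 ^ a) * (labelWeight i * g i) := by
      rw [hfold]
      ring

end CommunicationTime

end NetworkOblivious

theorem mainTheorem4 (K : ℝ) (hK : 0 < K) :
    ∃ β : ℝ, 0 < β ∧ β ≤ 1 ∧
      ∀ (k a : ℕ) (ha : 0 < a), 2 ^ a ≤ 4 ^ k →
        ∀ g ℓ : Fin a → ℝ, (∀ i, 0 < g i) → (∀ i, 0 ≤ ℓ i) →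
          Antitone g → Antitone (fun i => ℓ i / g i) →
          ℓ ⟨0, ha⟩ / g ⟨0, ha⟩ ≤ K * ((4 : ℝ) ^ k / 2 ^ a) →
          IsOptimal (MMClass a) a g ℓ β ((mmProgram k).fold (2 * k - a)) := by
  refine ⟨1 / (8100 * (15 + 3 * K)), by positivity, ?_,
    fun k a ha hpow g ℓ hg hℓ hanti hratio hbound => ?_⟩
  · rw [div_le_one (by positivity)]
    linarith
  have hak : a ≤ 2 * k := by
    rwa [four_pow_eq_two_pow, Nat.pow_le_pow_iff_right one_lt_two] at hpow
  have hn : ((2 ^ k : ℕ) : ℝ) ^ 2 = 4 ^ k := by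
    rw [← Nat.cast_pow, ← pow_mul, mul_comm, ← four_pow_eq_two_pow, Nat.cast_pow, Nat.cast_ofNat]
  refine ⟨mmClass_mmProgram_fold ha hak, fun Q hQ => ?_⟩
  have hlower := hQ.commTime_ge (Nat.two_pow_pos k) (fun i => (hg i).le) hℓ hanti
  rw [hn] at hlower
  calc ((mmProgram k).fold (2 * k - a)).commTime a g ℓ
    _ ≤ (15 + 3 * K) * ((4 : ℝ) ^ k / 2 ^ a) * ∑ i : Fin a, labelWeight i * g i :=
      commTime_mmProgram_fold_le hK.le ha hak hg hratio hbound
    _ = 8100 * (15 + 3 * K) *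
        ((4 : ℝ) ^ k / (8100 * 2 ^ a) * ∑ i : Fin a, labelWeight i * g i) := by field_simp
    _ ≤ 8100 * (15 + 3 * K) * Q.commTime a g ℓ := by gcongr
    _ = 1 / (1 / (8100 * (15 + 3 * K))) * Q.commTime a g ℓ := by rw [one_div_one_div]
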